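/- A unary probabilistic Turing machine (PTM) has input alphabet $\{a\}$, a read-only two-way input tape holding the input between two end-markers, one two-way infinite work tape, finitely many states and work symbols, and arbitrary real transition probabilities. It runs in polynomial time if, on every input of length $n$, every computation path halts within a number of steps that is polynomial in $n$. It uses space $O(\log\log n)$ if the maximum, over all computation paths on inputs of length $n$, of the number of visited work tape cells is $O(\log\log n)$. It recognizes a language $L$ with error bound $\epsilon$ if every member of $L$ is accepted with probability at least $1-\epsilon$ and every non-member with probability at most $\epsilon$; it recognizes $L$ with bounded error if this holds for some $0\le\epsilon<1/2$. For $n>0$ let $F(n)$ be the least positive integer that does not divide $n$. For a set $I\subseteq\mathbb{Z}^+$ of positive integers let $$\mathtt{AM75'}(I)=\{a^n \mid n>0,\ F(n)=64^m \text{ for some } m\in I\},$$ and let $p_I=0.x_1\,0\,1\,x_2\,0\,1\,x_3\,0\,1\cdots$ (in binary), where $x_i=1$ if $i\in I$ and $x_i=0$ otherwise. **Theorem.** Polynomial-time, bounded-error unary PTMs using $O(\log\log n)$ space recognize uncountably many languages. More precisely: 1. For every $I\subseteq\mathbb{Z}^+$ there is a unary PTM, all of whose transition probabilities lie in $\{0,1,p_I,1-p_I\}$,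 which runs in polynomial time, uses space $O(\log\log n)$, and recognizes $\mathtt{AM75'}(I)$ with error bound $1/4$. Moreover, if $n=0$ or $F(n)$ is not of the form $64^m$ with $m\ge 1$, then the computation on $a^n$ is deterministic (the configuration after each number of steps is determined with probability 1) and does not accept; and if $n>0$ and $F(n)=64^m$ with $m\ge 1$, then the probability that the machine accepts $a^n$ equals the probability that the binary digit of weight $2^{3m+2}$ (the $(3m-2)$-th digit of the $6m$-digit binary representation that starts at weight $2^{6m-1}$) of the number of heads in $64^m$ independent tosses of a coin with heads probability $p_I$ is $1$. In particular, this digit equals $x_m$ with probability at least $3/4$. 2. The set $\{\mathtt{AM75'}(I) \mid I\subseteq\mathbb{Z}^+\}$ is uncountable; hence the set of all languages recognized with bounded error by polynomial-time unary PTMs using $O(\log\log n)$ space is uncountable. -/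

import Mathlib

open Filter Asymptotics

/-- The symbols on the input tape: the two end-markers and the letters of the input alphabet. -/
inductive InputSymbol (A : Type) : Type where
  | leftEnd : InputSymbol A
  | letter (a : A) : InputSymbol A
  | rightEnd : InputSymbol A

/-- The possible moves of a tape head. -/
inductive HeadMove : Type where
  | left : HeadMove
  | stay : HeadMove
  | right : HeadMove

/-- A probabilistic Turing machine over the input alphabet `A`, with a two-way read-only input
tape and one two-way infinite work tape.  A work tape symbol is an element of `Option Γ`, where
`none` is the blank.  Given the state, the scanned input symbol and the scanned work symbol, the
next state, the symbol written, the move of the input head and the move of the work head (in this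
order) are drawn from an arbitrary (real-valued) probability distribution.  The input head never
leaves the part of the input tape between the two end-markers. -/
structure PTM (A : Type) where
  S : Type
  Γ : Type
  finite_S : Finite S
  finite_Γ : Finite Γ
  δ : S → InputSymbol A → Option Γ → PMF (S × Option Γ × HeadMove × HeadMove)
  start : S
  acc : S
  rej : S
  acc_ne_rej : acc ≠ rej
  leftEnd_move : ∀ s γ, ∀ r ∈ (δ s InputSymbol.leftEnd γ).support, r.2.2.1 ≠ HeadMove.left
  rightEnd_move : ∀ s γ, ∀ r ∈ (δ s InputSymbol.rightEnd γ).support, r.2.2.1 ≠ HeadMove.right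

namespace PTM

variable {A : Type}

/-- The symbol in cell `i` of the input tape holding `w`: cell `0` holds the left end-marker,
cells `1, …, |w|` hold the letters of `w`, cell `|w| + 1` holds the right end-marker
(the cells further to the right are never visited). -/
def inputSymbol (w : List A) (i : ℕ) : InputSymbol A :=
  match i with
  | 0 => InputSymbol.leftEnd
  | j + 1 =>
    match w[j]? with
    | some a => InputSymbol.letter a
    | none => InputSymbol.rightEnd

/-- The new position of the input head (the truncated case, a move to the left from cell `0`,
never occurs). -/
def moveInput (d : HeadMove) (i : ℕ) : ℕ :=
  match d with
  | HeadMove.left => i - 1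
  | HeadMove.stay => i
  | HeadMove.right => i + 1

/-- The new position of the work head. -/
def moveWork (d : HeadMove) (i : ℤ) : ℤ :=
  match d with
  | HeadMove.left => i - 1
  | HeadMove.stay => i
  | HeadMove.right => i + 1

/-- A configuration of `M`, together with the record `visited` of the work tape cells that the
work head has visited so far.  The record does not influence the computation. -/
structure Config (M : PTM A) where
  state : M.S
  inputPos : ℕ
  tape : ℤ → Option M.Γ
  workPos : ℤ
  visited : Finset ℤ

/-- The initial configuration: initial state, input head on the left end-marker, blank work
tape with its head on cell `0`. -/
def init (M : PTM A) : Config M where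
  state := M.start
  inputPos := 0
  tape := fun _ => none
  workPos := 0
  visited := {0}

/-- The configuration that follows `c` when the outcome `r` is drawn. -/
def next (M : PTM A) (c : Config M) (r : M.S × Option M.Γ × HeadMove × HeadMove) : Config M where
  state := r.1
  inputPos := moveInput r.2.2.1 c.inputPos
  tape := Function.update c.tape c.workPos r.2.1
  workPos := moveWork r.2.2.2 c.workPos
  visited := insert (moveWork r.2.2.2 c.workPos) c.visited

/-- The computation has terminated. -/
def Halted (M : PTM A) (c : Config M) : Prop :=
  c.state = M.acc ∨ c.state = M.rej

open Classical in
/-- One step of the computation on the input `w`; a halted configuration does not change. -/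
noncomputable def step (M : PTM A) (w : List A) (c : Config M) : PMF (Config M) :=
  if M.Halted c then PMF.pure c
  else (M.δ c.state (inputSymbol w c.inputPos) (c.tape c.workPos)).map (M.next c)

/-- The distribution of the configuration after `t` steps on the input `w`. -/
noncomputable def run (M : PTM A) (w : List A) : ℕ → PMF (Config M)
  | 0 => PMF.pure M.init
  | t + 1 => (run M w t).bind (M.step w)

/-- The probability that `M` accepts `w`, i.e. the limit (supremum) over `t` of the probability
that `M` has entered the accepting state within `t` steps. -/
noncomputable def acceptProb (M : PTM A) (w : List A) : ℝ :=
  (⨆ t : ℕ, (M.run w t).toOuterMeasure {c | c.state = M.acc}).toReal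

/-- `M` recognizes `L` with error bound `ε`. -/
def RecognizesWithError (M : PTM A) (L : Language A) (ε : ℝ) : Prop :=
  (∀ w ∈ L, 1 - ε ≤ M.acceptProb w) ∧ (∀ w ∉ L, M.acceptProb w ≤ ε)

/-- `M` recognizes `L` with bounded error. -/
def RecognizesWithBoundedError (M : PTM A) (L : Language A) : Prop :=
  ∃ ε : ℝ, 0 ≤ ε ∧ ε < 1 / 2 ∧ M.RecognizesWithError L ε

/-- `M` runs in polynomial time: on every input, every computation path of `M` halts within a
number of steps that is polynomial in the length of the input. -/
def PolynomialTime (M : PTM A) : Prop :=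
  ∃ P : Polynomial ℕ, ∀ w : List A, ∀ c ∈ (M.run w (P.eval w.length)).support, M.Halted c

/-- `M` uses space `O(f(n))`: the number of work tape cells visited on any computation path on any
input of length `n` is at most `s(n)`, where `s = O(f)`. -/
def SpaceBigO (M : PTM A) (f : ℕ → ℝ) : Prop :=
  ∃ s : ℕ → ℕ,
    (∀ w : List A, ∀ t : ℕ, ∀ c ∈ (M.run w t).support, c.visited.card ≤ s w.length) ∧
    (fun n => (s n : ℝ)) =O[atTop] f

end PTM

/-- `F n` is the least positive integer that does not divide `n` (for `n > 0`). -/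
noncomputable def leastNonDivisor (n : ℕ) : ℕ :=
  sInf {i : ℕ | 0 < i ∧ ¬ i ∣ n}

/-- The unary language of all `a ^ n` with `n > 0` such that `F n = 64 ^ m` with `m ∈ I`. -/
def AM75' (I : Set ℕ+) : Language Unit :=
  {w | ∃ n : ℕ, 0 < n ∧ w = List.replicate n () ∧
    ∃ m : ℕ+, leastNonDivisor n = 64 ^ (m : ℕ) ∧ m ∈ I}

open Classical in
/-- The binary digits `x₁ 0 1 x₂ 0 1 x₃ 0 1 …` (indexed from `0`), where `xᵢ = 1` iff `i ∈ I`. -/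
noncomputable def coinDigits (I : Set ℕ+) (j : ℕ) : Fin 2 :=
  if j % 3 = 0 then (if Nat.succPNat (j / 3) ∈ I then 1 else 0)
  else if j % 3 = 1 then 0
  else 1

/-- The number `p_I = 0.x₁01x₂01x₃01…` in binary. -/
noncomputable def coinBias (I : Set ℕ+) : ℝ :=
  Real.ofDigits (coinDigits I)

/-- The probability that, in `N` independent tosses of a coin that lands heads with probability
`p`, the binary digit of weight `2 ^ b` of the number of heads is `1`. -/
noncomputable def headCountBitProb (p : ℝ) (N b : ℕ) : ℝ :=
  ∑ h ∈ (Finset.range (N + 1)).filter (fun h => h.testBit b = true),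
    (N.choose h : ℝ) * p ^ h * (1 - p) ^ (N - h)

/-! The machine searches for `F(n)` deterministically and then extracts one binary digit of the
coin's bias. It tries the moduli `k = 1, 2, 3, …`, sweeping the input once per modulus with a
counter that runs cyclically through `1, …, k`. The counter ends at `k` iff `k ∣ n`, so the first
failure occurs at `k = F(n)`. Unless this is a power of `64`, the machine rejects. If `k = 64 ^ m`,
it tosses `k` coins, reusing the counter, and accepts iff bit `3 * m + 2` of the number of heads is
`1`.

Space: if `2 * m < F(n)`, every prime power in the central binomial coefficient of `m` is at most `2
* m` and hence divides `n`; so this coefficient, which is at least `2 ^ m`, divides `n`. Therefore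
`F(n) = O(log n)` (`leastNonDivisor_le_log`), and `F(n)` has `O(log log n)` digits in base `64`. The
heads are counted modulo `8 ^ (m + 1)`, one octal digit per base-`64` digit of the modulus, so the
three numbers fit on parallel tracks, and the wanted bit is the top bit of the last octal digit.

Error: the octal digit of `p_I` at place `m` is `x_m 0 1`, so `64 ^ m * p_I` equals `8 ^ m * (8 * a
+ 4 * x_m + 1 + r)` with `0 ≤ r ≤ 1` (`exists_pow_mul_coinBias_eq`). The pattern `0 1` leaves a
margin of `8 ^ m` on either side before bit `3 * m + 2` changes (`testBit_eq_of_abs_sub_lt`). As `8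
^ m` is the square root of the number of tosses, Chebyshev bounds the failure probability by `p * (1
- p) ≤ 1 / 4`.

Uncountability: each power `64 ^ m` is a value of `F`, so `I` can be recovered from its language
(`AM75'_injective`), and Cantor's theorem applies.

`exists_detRun_search` (the search), `runFrom_tosses` (the tosses) and `scanFull_tape` with
`scanFull_tape_succ` (the arithmetic on the tape) tie the machine to these facts. -/

namespace PTM

/-! ### Runs of a probabilistic Turing machine, time and space bounds, deterministic segments -/

variable {A : Type} (M : PTM A) (w : List A)

/-- The distribution of the configuration after `t` steps, starting from `c`. -/
noncomputable def runFrom (c : M.Config) : ℕ → PMF M.Config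
  | 0 => PMF.pure c
  | t + 1 => (runFrom c t).bind (M.step w)

theorem run_eq_runFrom (t : ℕ) : M.run w t = M.runFrom w M.init t := by
  induction t with
  | zero => rfl
  | succ t ih => simp [run, runFrom, ih]

theorem runFrom_add (c : M.Config) (s t : ℕ) :
    M.runFrom w c (s + t) = (M.runFrom w c s).bind fun d => M.runFrom w d t := by
  induction t with
  | zero => simp [runFrom]
  | succ t ih => simp [runFrom, ih]

variable {M w} in
theorem step_of_halted {c : M.Config} (h : M.Halted c) : M.step w c = PMF.pure c := by
  simp [step, h]

variable {M w} in
theorem runFrom_of_halted {c : M.Config} (h : M.Halted c) (t : ℕ) :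
    M.runFrom w c t = PMF.pure c := by
  induction t with
  | zero => rfl
  | succ t ih => simp [runFrom, ih, step_of_halted h]

variable {M w} in
theorem runFrom_add_of_halted {c : M.Config} {T : ℕ}
    (h : ∀ d ∈ (M.runFrom w c T).support, M.Halted d) (t : ℕ) :
    M.runFrom w c (T + t) = M.runFrom w c T := by
  induction t with
  | zero => rfl
  | succ t ih =>
    rw [← add_assoc, runFrom, ih]
    refine PMF.ext fun d => ?_
    rw [PMF.bind_apply]
    conv_rhs => rw [← PMF.bind_pure (M.runFrom w c T), PMF.bind_apply]
    refine tsum_congr fun e => ?_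
    by_cases he : e ∈ (M.runFrom w c T).support
    · rw [step_of_halted (h e he)]
    · rw [PMF.mem_support_iff, not_not] at he
      simp [he]

/-- Add the cells in `V` to the record of the visited cells. -/
def addVisited (V : Finset ℤ) (c : M.Config) : M.Config :=
  { c with visited := c.visited ∪ V }

/-- No transition looks at the record of visited cells. The analysis may therefore start with all
permitted cells already recorded; as long as the head stays among them the record is constant, and
configurations can be written down exactly. -/
theorem step_addVisited (V : Finset ℤ) (c : M.Config) :
    M.step w (M.addVisited V c) = (M.step w c).map (M.addVisited V) := by
  by_cases h : M.Halted c
  · rw [step_of_halted h, step_of_halted (show M.Halted (M.addVisited V c) from h), PMF.pure_map]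
  · have h' : ¬ M.Halted (M.addVisited V c) := h
    simp only [step, h, h', if_false, PMF.map_comp]
    congr 1
    funext r
    simp [addVisited, next, Finset.insert_union]

theorem runFrom_addVisited (V : Finset ℤ) (c : M.Config) (t : ℕ) :
    M.runFrom w (M.addVisited V c) t = (M.runFrom w c t).map (M.addVisited V) := by
  induction t with
  | zero => simp [runFrom, PMF.pure_map]
  | succ t ih =>
    rw [runFrom, ih, PMF.bind_map, runFrom, PMF.map_bind]
    congr 1
    funext d
    exact M.step_addVisited w V d

variable {M w} in
theorem visited_subset_of_mem_step {c d : M.Config} (h : d ∈ (M.step w c).support) :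
    c.visited ⊆ d.visited := by
  by_cases hc : M.Halted c
  · rw [step_of_halted hc, PMF.support_pure, Set.mem_singleton_iff] at h
    rw [h]
  · simp only [step, hc, if_false, PMF.support_map] at h
    obtain ⟨r, -, rfl⟩ := h
    exact Finset.subset_insert _ _

variable {M w} in
theorem visited_subset_of_mem_runFrom {c d : M.Config} {t : ℕ}
    (h : d ∈ (M.runFrom w c t).support) : c.visited ⊆ d.visited := by
  induction t generalizing d with
  | zero =>
    rw [runFrom, PMF.support_pure, Set.mem_singleton_iff] at h
    rw [h]
  | succ t ih =>
    rw [runFrom, PMF.mem_support_bind_iff] at h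
    obtain ⟨e, he, hd⟩ := h
    exact (ih he).trans (visited_subset_of_mem_step hd)

/-- The hypotheses under which a bound on time and space of `M` on `w` is read off from the
distribution of the configuration at time `T`, where the cells in `V` are counted as visited from
the beginning. -/
structure HaltsWithin (V : Finset ℤ) (T : ℕ) : Prop where
  halted : ∀ d ∈ (M.runFrom w (M.addVisited V M.init) T).support, M.Halted d
  visited : ∀ d ∈ (M.runFrom w (M.addVisited V M.init) T).support, d.visited ⊆ V

namespace HaltsWithin

variable {M w} {V : Finset ℤ} {T : ℕ}

theorem addVisited_mem {c : M.Config} {t : ℕ} (hc : c ∈ (M.run w t).support) :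
    M.addVisited V c ∈ (M.runFrom w (M.addVisited V M.init) t).support := by
  rw [runFrom_addVisited, PMF.support_map, ← run_eq_runFrom]
  exact Set.mem_image_of_mem _ hc

theorem halted_run (H : M.HaltsWithin w V T) {c : M.Config} (hc : c ∈ (M.run w T).support) :
    M.Halted c :=
  H.halted (M.addVisited V c) (addVisited_mem hc)

theorem run_eq (H : M.HaltsWithin w V T) {t : ℕ} (ht : T ≤ t) : M.run w t = M.run w T := by
  obtain ⟨s, rfl⟩ := Nat.exists_eq_add_of_le ht
  rw [run_eq_runFrom, run_eq_runFrom]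
  refine runFrom_add_of_halted (fun d hd => ?_) s
  rw [← run_eq_runFrom] at hd
  exact H.halted_run hd

/-- A path of any length `t` extends to one of length `t + T`, where the distribution is already the
final one. The record only grows along a path, so the bound at time `T` covers all earlier
configurations. -/
theorem visited_run (H : M.HaltsWithin w V T) {c : M.Config} {t : ℕ}
    (hc : c ∈ (M.run w t).support) : c.visited ⊆ V := by
  obtain ⟨d, hd⟩ := (M.runFrom w c T).support_nonempty
  have h1 : d ∈ (M.run w (t + T)).support := by
    rw [run_eq_runFrom, runFrom_add, PMF.mem_support_bind_iff]
    exact ⟨c, by rwa [← run_eq_runFrom], hd⟩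
  rw [H.run_eq (Nat.le_add_left T t)] at h1
  exact ((visited_subset_of_mem_runFrom hd).trans Finset.subset_union_left).trans
    (H.visited _ (addVisited_mem h1))

theorem toOuterMeasure_run_le_succ (t : ℕ) :
    (M.run w t).toOuterMeasure {c | c.state = M.acc} ≤
      (M.run w (t + 1)).toOuterMeasure {c | c.state = M.acc} := by
  rw [run, PMF.toOuterMeasure_bind_apply, PMF.toOuterMeasure_apply]
  refine ENNReal.tsum_le_tsum fun c => ?_
  by_cases hc : c.state = M.acc
  · rw [step_of_halted (Or.inl hc), PMF.toOuterMeasure_pure_apply]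
    simp [hc]
  · simp [hc]

theorem acceptProb_eq (H : M.HaltsWithin w V T) :
    M.acceptProb w = ((M.runFrom w (M.addVisited V M.init) T).toOuterMeasure
      {c | c.state = M.acc}).toReal := by
  have h : (⨆ t : ℕ, (M.run w t).toOuterMeasure {c | c.state = M.acc}) =
      (M.run w T).toOuterMeasure {c | c.state = M.acc} := by
    refine le_antisymm (iSup_le fun t => ?_) (le_iSup (fun t =>
      (M.run w t).toOuterMeasure {c | c.state = M.acc}) T)
    rw [← H.run_eq (le_max_right t T)]
    exact monotone_nat_of_le_succ (f := fun t => (M.run w t).toOuterMeasure {c | c.state = M.acc})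
      toOuterMeasure_run_le_succ (le_max_left t T)
  rw [acceptProb, h, runFrom_addVisited, PMF.toOuterMeasure_map_apply, run_eq_runFrom]
  rfl

end HaltsWithin

/-- One step of the computation that is taken with probability `1`. -/
def DetStep (c d : M.Config) : Prop :=
  ¬ M.Halted c ∧
    ∃ r, M.δ c.state (inputSymbol w c.inputPos) (c.tape c.workPos) = PMF.pure r ∧ d = M.next c r

/-- `t` successive steps each of which is taken with probability `1`. -/
inductive DetRun : ℕ → M.Config → M.Config → Prop
  | refl (c) : DetRun 0 c c
  | head {t c d e} : M.DetStep w c d → DetRun t d e → DetRun (t + 1) c e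

variable {M w}

theorem DetStep.step_eq {c d : M.Config} (h : M.DetStep w c d) : M.step w c = PMF.pure d := by
  obtain ⟨h1, r, h2, rfl⟩ := h
  simp [step, h1, h2, PMF.pure_map]

theorem DetStep.detRun {c d : M.Config} (h : M.DetStep w c d) : M.DetRun w 1 c d :=
  .head h (.refl d)

theorem DetStep.of_addVisited {V : Finset ℤ} {c d : M.Config}
    (h : M.DetStep w (M.addVisited V c) d) : ∃ e, M.DetStep w c e ∧ M.addVisited V e = d := by
  obtain ⟨h1, r, h2, rfl⟩ := h
  exact ⟨M.next c r, ⟨h1, r, h2, rfl⟩, by simp [addVisited, next, Finset.insert_union]⟩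

namespace DetRun

theorem trans {s t : ℕ} {c d e : M.Config} (h : M.DetRun w s c d) (h' : M.DetRun w t d e) :
    M.DetRun w (s + t) c e := by
  induction h with
  | refl c => simpa using h'
  | head h1 _ ih => rw [Nat.add_right_comm]; exact .head h1 (ih h')

theorem runFrom_succ (c : M.Config) (t : ℕ) :
    M.runFrom w c (t + 1) = (M.step w c).bind fun d => M.runFrom w d t := by
  rw [add_comm, runFrom_add]
  simp [runFrom]

theorem runFrom_eq {t : ℕ} {c d : M.Config} (h : M.DetRun w t c d) :
    M.runFrom w c t = PMF.pure d := by
  induction h with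
  | refl c => rfl
  | head h1 _ ih => rw [runFrom_succ, h1.step_eq, PMF.pure_bind, ih]

theorem exists_of_le {s t : ℕ} {c d : M.Config} (h : M.DetRun w t c d) (hs : s ≤ t) :
    ∃ e, M.runFrom w c s = PMF.pure e := by
  induction h generalizing s with
  | refl c => exact ⟨c, by rw [Nat.le_zero.1 hs]; rfl⟩
  | @head t c d e h1 _ ih =>
    cases s with
    | zero => exact ⟨c, rfl⟩
    | succ s =>
      obtain ⟨f, hf⟩ := ih (Nat.le_of_succ_le_succ hs)
      exact ⟨f, by rw [runFrom_succ, h1.step_eq, PMF.pure_bind, hf]⟩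

theorem of_addVisited {V : Finset ℤ} {t : ℕ} {c d : M.Config}
    (h : M.DetRun w t (M.addVisited V c) d) : ∃ e, M.DetRun w t c e ∧ M.addVisited V e = d := by
  generalize hb : M.addVisited V c = b at h
  induction h generalizing c with
  | refl => exact ⟨c, .refl c, hb⟩
  | head h1 _ ih =>
    subst hb
    obtain ⟨e, he, rfl⟩ := h1.of_addVisited
    obtain ⟨f, hf, hf'⟩ := ih rfl
    exact ⟨f, .head he hf, hf'⟩

theorem exists_run_eq_pure {V : Finset ℤ} {T : ℕ} {d : M.Config}
    (h : M.DetRun w T (M.addVisited V M.init) d) (hd : M.Halted d) (t : ℕ) :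
    ∃ c, M.run w t = PMF.pure c := by
  obtain ⟨e, he, rfl⟩ := h.of_addVisited
  rw [run_eq_runFrom]
  rcases le_total t T with ht | ht
  · exact he.exists_of_le ht
  · obtain ⟨s, rfl⟩ := Nat.exists_eq_add_of_le ht
    exact ⟨e, by rw [runFrom_add, he.runFrom_eq, PMF.pure_bind,
      runFrom_of_halted (show M.Halted e from hd)]⟩

end DetRun

end PTM

/-! ### The size and the values of the least non-divisor -/

section LeastNonDivisor

theorem leastNonDivisor_spec {n : ℕ} (hn : 0 < n) :
    0 < leastNonDivisor n ∧ ¬ leastNonDivisor n ∣ n :=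
  Nat.sInf_mem (s := {i : ℕ | 0 < i ∧ ¬ i ∣ n})
    ⟨n + 1, n.succ_pos, fun h => absurd (Nat.le_of_dvd hn h) (by omega)⟩

theorem dvd_of_lt_leastNonDivisor {n i : ℕ} (hi : 0 < i) (h : i < leastNonDivisor n) : i ∣ n := by
  by_contra hd
  exact absurd (Nat.sInf_le (s := {i : ℕ | 0 < i ∧ ¬ i ∣ n}) ⟨hi, hd⟩) (not_le.2 h)

theorem leastNonDivisor_eq {n k : ℕ} (hk : 0 < k) (hd : ¬ k ∣ n)
    (h : ∀ i, 0 < i → i < k → i ∣ n) : leastNonDivisor n = k := by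
  refine le_antisymm (Nat.sInf_le ⟨hk, hd⟩) (le_csInf ⟨k, hk, hd⟩ fun i hi => ?_)
  by_contra hik
  exact hi.2 (h i hi.1 (not_le.1 hik))

theorem leastNonDivisor_le_succ {n : ℕ} (hn : 0 < n) : leastNonDivisor n ≤ n + 1 :=
  Nat.sInf_le ⟨n.succ_pos, fun h => absurd (Nat.le_of_dvd hn h) (by omega)⟩

/-- Each prime power exactly dividing `(2m).choose m` is at most `2m`, hence below the least
non-divisor, hence a divisor of `n`. This replaces a bound on `lcm(1, …, 2m)`. -/
theorem centralBinom_dvd_of_lt_leastNonDivisor {n m : ℕ} (hn : 0 < n) (hm : 0 < m)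
    (h : 2 * m < leastNonDivisor n) : m.centralBinom ∣ n := by
  refine (Nat.factorization_prime_le_iff_dvd m.centralBinom_ne_zero hn.ne').1 fun p hp => ?_
  rw [← hp.pow_dvd_iff_le_factorization hn.ne']
  refine dvd_of_lt_leastNonDivisor (pow_pos hp.pos _) (lt_of_le_of_lt ?_ h)
  rw [Nat.centralBinom]
  exact Nat.pow_factorization_choose_le (by omega)

theorem leastNonDivisor_le_log {n : ℕ} (hn : 0 < n) :
    leastNonDivisor n ≤ 2 * Nat.log 2 n + 2 := by
  by_contra! h
  set m := Nat.log 2 n + 1 with hm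
  have h1 := Nat.le_of_dvd hn (centralBinom_dvd_of_lt_leastNonDivisor hn (by omega)
    (show 2 * m < leastNonDivisor n by omega))
  -- This crude growth suffices: with `m = log₂ n + 1` it makes a divisor of `n` exceed `n`.
  have h2 : ∀ j : ℕ, 2 ^ j ≤ j.centralBinom := by
    intro j
    induction j with
    | zero => simp
    | succ j ih =>
      have h3 := Nat.succ_mul_centralBinom_succ j
      have h4 : (j + 1) * (2 * j.centralBinom) ≤ (j + 1) * (j + 1).centralBinom := by
        rw [h3]; nlinarith [j.centralBinom_pos]
      have h5 := Nat.le_of_mul_le_mul_left h4 j.succ_pos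
      rw [pow_succ]; omega
  exact absurd ((h2 m).trans h1) (not_le.2 (Nat.lt_pow_succ_log_self (by norm_num) n))

/-- The witness is `2 ^ e` times the odd part of `(2 ^ (e + 1))!`. A smaller `i` has 2-part at most
`2 ^ e`, and its odd part divides that of the factorial. -/
theorem exists_leastNonDivisor_eq_two_pow (e : ℕ) :
    ∃ n, 0 < n ∧ leastNonDivisor n = 2 ^ (e + 1) := by
  have hf : (2 ^ (e + 1)).factorial ≠ 0 := Nat.factorial_ne_zero _
  set u := ordCompl[2] (2 ^ (e + 1)).factorial with hu
  have hu0 : 0 < u := Nat.ordCompl_pos 2 hf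
  have hcop : Nat.Coprime 2 u := Nat.coprime_ordCompl Nat.prime_two hf
  refine ⟨2 ^ e * u, by positivity, leastNonDivisor_eq (by positivity) ?_ ?_⟩
  · rw [pow_succ, Nat.mul_dvd_mul_iff_left (by positivity)]
    intro h
    have := Nat.Coprime.eq_one_of_dvd hcop h
    omega
  · intro i hi hlt
    rw [← Nat.ordProj_mul_ordCompl_eq_self i 2]
    refine Nat.mul_dvd_mul (pow_dvd_pow 2 ?_) ?_
    · have h1 : 2 ^ i.factorization 2 ≤ i := Nat.ordProj_le 2 hi.ne'
      exact Nat.lt_succ_iff.1 ((Nat.pow_lt_pow_iff_right (by norm_num)).1 (h1.trans_lt hlt))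
    · exact Nat.ordCompl_dvd_ordCompl_of_dvd (Nat.dvd_factorial hi hlt.le) 2

theorem AM75'_injective : Function.Injective AM75' := by
  intro I J h
  ext m
  have hm : 6 * (m : ℕ) = (6 * (m : ℕ) - 1) + 1 := by have := m.pos; omega
  obtain ⟨n, hn, hF⟩ := exists_leastNonDivisor_eq_two_pow (6 * (m : ℕ) - 1)
  rw [← hm, pow_mul, show 2 ^ 6 = 64 by norm_num] at hF
  have key : ∀ K : Set ℕ+, List.replicate n () ∈ AM75' K ↔ m ∈ K := by
    intro K
    constructor
    · rintro ⟨n', -, hw, m', hm', hK⟩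
      obtain rfl : n = n' := by simpa using congrArg List.length hw
      rw [hF] at hm'
      have := Nat.pow_right_injective (by norm_num : 2 ≤ 64) hm'
      rwa [PNat.coe_injective this]
    · intro hK
      exact ⟨n, hn, rfl, m, hF, hK⟩
  rw [← key I, ← key J, h]

theorem not_countable_range_AM75' : ¬ (Set.range AM75').Countable := by
  intro h
  have : Countable (Set ℕ+) := by
    have := h.to_subtype
    exact (Set.rangeFactorization_injective.2 AM75'_injective).countable
  obtain ⟨f, hf⟩ := exists_injective_nat (Set ℕ+)
  -- Countably many languages would give an injection of the power set of `ℕ+` into `ℕ+`.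
  exact Function.cantor_injective (fun s => Nat.succPNat (f s))
    (Nat.succPNat_injective.comp hf)

theorem isBigO_clog_leastNonDivisor (b : ℕ) :
    (fun n => ((Nat.clog 64 (leastNonDivisor n + 1) + b : ℕ) : ℝ)) =O[atTop]
      fun n : ℕ => Real.log (Real.log n) := by
  have hev : ∀ᶠ n : ℕ in atTop, 1 ≤ Real.log (Real.log n) :=
    (Real.tendsto_log_atTop.comp (Real.tendsto_log_atTop.comp
      tendsto_natCast_atTop_atTop)).eventually_ge_atTop 1
  -- From `64 ^ L ≤ F(n) ≤ 8 log n` one gets `L ≤ log 8 + log log n`; the remaining constants are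
  -- absorbed because `log log n ≥ 1` eventually.
  refine IsBigO.of_bound (Real.log 8 + b + 2) ?_
  filter_upwards [hev, eventually_ge_atTop 3] with n h1 h3
  have hn : (3 : ℝ) ≤ n := by exact_mod_cast h3
  have hlog1 : 1 ≤ Real.log n := by
    rw [Real.le_log_iff_exp_le (by linarith)]
    exact Real.exp_one_lt_three.le.trans hn
  have hF : ((leastNonDivisor n : ℕ) : ℝ) ≤ 8 * Real.log n := by
    have h4 : ((leastNonDivisor n : ℕ) : ℝ) ≤ 2 * (Nat.log 2 n : ℝ) + 2 := by
      exact_mod_cast leastNonDivisor_le_log (by omega : 0 < n)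
    have h5 : (Nat.log 2 n : ℝ) * Real.log 2 ≤ Real.log n := by
      rw [← Real.log_pow]
      apply Real.log_le_log (by positivity)
      exact_mod_cast Nat.pow_log_le_self 2 (by omega)
    have h6 : (1 / 2 : ℝ) ≤ Real.log 2 := by linarith [Real.log_two_gt_d9]
    nlinarith [(Nat.cast_nonneg (Nat.log 2 n) : (0 : ℝ) ≤ _)]
  have hF0 := (leastNonDivisor_spec (by omega : 0 < n)).1
  obtain ⟨L, hL⟩ : ∃ L, Nat.clog 64 (leastNonDivisor n + 1) = L + 1 :=
    Nat.exists_eq_succ_of_ne_zero (Nat.clog_pos (by norm_num) (by omega)).ne'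
  have hpow : (64 : ℝ) ^ L ≤ leastNonDivisor n := by
    have := Nat.pow_lt_of_lt_clog (b := 64) (show L < Nat.clog 64 (leastNonDivisor n + 1) by omega)
    exact_mod_cast Nat.lt_succ_iff.1 this
  have h7 : (L : ℝ) * Real.log 64 ≤ Real.log 8 + Real.log (Real.log n) := by
    rw [← Real.log_pow, ← Real.log_mul (by norm_num) (by linarith)]
    exact Real.log_le_log (by positivity) (hpow.trans hF)
  have h8 : 1 ≤ Real.log 64 := by
    rw [Real.le_log_iff_exp_le (by norm_num)]
    linarith [Real.exp_one_lt_three]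
  have h9 : 0 ≤ Real.log 8 := Real.log_nonneg (by norm_num)
  rw [hL, Real.norm_of_nonneg (by positivity), Real.norm_of_nonneg (by linarith)]
  push_cast
  nlinarith [(Nat.cast_nonneg L : (0 : ℝ) ≤ _), (Nat.cast_nonneg b : (0 : ℝ) ≤ _)]

end LeastNonDivisor

/-! ### The binomial distribution of the number of heads -/

section HeadCount

open scoped NNReal

variable (p : ℝ≥0) (hp : p ≤ 1)

/-- A coin toss that yields `true` (heads) with probability `p`. -/
noncomputable def coin : PMF Bool :=
  PMF.ofFintype (fun b => cond b (p : ENNReal) (1 - p : ℝ≥0)) (by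
    rw [Fintype.sum_bool, cond_true, cond_false, ← ENNReal.coe_add, ENNReal.coe_eq_one]
    exact add_tsub_cancel_of_le hp)

/-- The distribution of the number of heads in `N` independent tosses of a coin with bias `p`. -/
noncomputable def headCount : ℕ → PMF ℕ
  | 0 => PMF.pure 0
  | N + 1 => (headCount N).bind fun h => (coin p hp).map fun b => h + b.toNat

/-- Conditioning on the last toss leaves two predecessors of a positive count, and Pascal's rule
adds up their weights. -/
theorem headCount_apply (N h : ℕ) :
    headCount p hp N h = (N.choose h * p ^ h * (1 - p) ^ (N - h) : ℝ≥0) := by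
  induction N generalizing h with
  | zero => cases h <;> simp [headCount, PMF.pure_apply]
  | succ N ih =>
    have key : headCount p hp (N + 1) h =
        ∑' j, headCount p hp N j * ((if h = j then ((1 - p : ℝ≥0) : ENNReal) else 0) +
          if h = j + 1 then (p : ENNReal) else 0) := by
      rw [headCount, PMF.bind_apply]
      refine tsum_congr fun j => ?_
      rw [PMF.map_apply, tsum_bool]
      simp [coin]
    simp only [mul_add, ENNReal.tsum_add] at key
    rw [tsum_eq_single h (by intro j hj; simp [hj.symm])] at key
    cases h with
    | zero =>
      rw [key, ih]
      simp [pow_succ]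
    | succ h =>
      rw [tsum_eq_single h (by intro j hj; simp [Ne.symm hj])] at key
      rw [key, ih, ih]
      simp only [if_true]
      norm_cast
      rw [Nat.choose_succ_succ, Nat.succ_sub_succ]
      rcases lt_or_ge h N with hN | hN
      · rw [show N - h = (N - (h + 1)) + 1 by omega]
        push_cast
        ring
      · rw [Nat.choose_eq_zero_of_lt (show N < h + 1 by omega)]
        push_cast
        ring

theorem toReal_headCount_testBit (N b : ℕ) :
    ((headCount p hp N).toOuterMeasure {h | h.testBit b = true}).toReal =
      headCountBitProb p N b := by
  have h1 : (headCount p hp N).toOuterMeasure {h | h.testBit b = true} =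
      (headCount p hp N).toOuterMeasure
        ((Finset.range (N + 1)).filter (fun h => h.testBit b = true) : Finset ℕ) := by
    refine PMF.toOuterMeasure_apply_eq_of_inter_support_eq _ ?_
    ext h
    simp only [Set.mem_inter_iff, Set.mem_ofPred_eq, PMF.mem_support_iff, Finset.coe_filter,
      Finset.mem_range, and_congr_left_iff]
    intro hh
    refine ⟨fun h' => ⟨?_, h'⟩, fun h' => h'.2⟩
    by_contra hlt
    rw [headCount_apply, Nat.choose_eq_zero_of_lt (by omega)] at hh
    simp at hh
  rw [h1, PMF.toOuterMeasure_apply_finset, headCountBitProb, ENNReal.toReal_sum]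
  · refine Finset.sum_congr rfl fun h _ => ?_
    rw [headCount_apply]
    rw [ENNReal.coe_toReal]
    push_cast [NNReal.coe_sub hp]
    ring
  · intro h _
    rw [headCount_apply]
    exact ENNReal.coe_ne_top

end HeadCount

/-! ### Reading a digit of the bias from the number of heads -/

section Chebyshev

theorem sum_choose_mul_pow (p : ℝ) (N : ℕ) :
    ∑ h ∈ Finset.range (N + 1), (N.choose h : ℝ) * p ^ h * (1 - p) ^ (N - h) = 1 := by
  have h := congrArg (Polynomial.eval p) (bernsteinPolynomial.sum ℝ N)
  simpa [bernsteinPolynomial, Polynomial.eval_finsetSum] using h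

theorem sum_sq_mul_choose_mul_pow (p : ℝ) (N : ℕ) :
    ∑ h ∈ Finset.range (N + 1),
      (N * p - h) ^ 2 * ((N.choose h : ℝ) * p ^ h * (1 - p) ^ (N - h)) = N * p * (1 - p) := by
  have h := congrArg (Polynomial.eval p) (bernsteinPolynomial.variance ℝ N)
  simpa [bernsteinPolynomial, Polynomial.eval_finsetSum] using h

/-- Chebyshev's inequality for the number of heads, with deviation at least `t ≥ √N`. -/
theorem sum_choose_mul_pow_of_deviation_le {p : ℝ} (hp0 : 0 ≤ p) (hp1 : p ≤ 1) {N : ℕ} {t : ℝ}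
    (ht : 0 < t) (hN : (N : ℝ) = t ^ 2) (s : Finset ℕ) (hs : s ⊆ Finset.range (N + 1))
    (hdev : ∀ h ∈ s, t ≤ |N * p - h|) :
    ∑ h ∈ s, (N.choose h : ℝ) * p ^ h * (1 - p) ^ (N - h) ≤ 1 / 4 := by
  have hnn : ∀ h : ℕ, 0 ≤ (N.choose h : ℝ) * p ^ h * (1 - p) ^ (N - h) := fun h => by
    have : 0 ≤ 1 - p := by linarith
    positivity
  have h1 : t ^ 2 * ∑ h ∈ s, (N.choose h : ℝ) * p ^ h * (1 - p) ^ (N - h) ≤ t ^ 2 * (1 / 4) := by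
    calc _ = ∑ h ∈ s, t ^ 2 * ((N.choose h : ℝ) * p ^ h * (1 - p) ^ (N - h)) := Finset.mul_sum ..
      _ ≤ ∑ h ∈ s, (N * p - h) ^ 2 * ((N.choose h : ℝ) * p ^ h * (1 - p) ^ (N - h)) := by
        refine Finset.sum_le_sum fun h hh => mul_le_mul_of_nonneg_right ?_ (hnn h)
        rw [← sq_abs (N * p - h)]
        exact pow_le_pow_left₀ ht.le (hdev h hh) 2
      _ ≤ ∑ h ∈ Finset.range (N + 1),
          (N * p - h) ^ 2 * ((N.choose h : ℝ) * p ^ h * (1 - p) ^ (N - h)) :=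
        Finset.sum_le_sum_of_subset_of_nonneg hs fun h _ _ => mul_nonneg (sq_nonneg _) (hnn h)
      _ = t ^ 2 * (p * (1 - p)) := by rw [sum_sq_mul_choose_mul_pow, hN]; ring
      _ ≤ t ^ 2 * (1 / 4) := by
        refine mul_le_mul_of_nonneg_left ?_ (sq_nonneg t)
        -- The variance of a single toss is at most `1 / 4`, which becomes the error bound.
        nlinarith [sq_nonneg (2 * p - 1)]
  exact le_of_mul_le_mul_left h1 (by positivity)

theorem coinBias_nonneg (I : Set ℕ+) : 0 ≤ coinBias I := Real.ofDigits_nonneg _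

theorem coinBias_le_one (I : Set ℕ+) : coinBias I ≤ 1 := Real.ofDigits_le_one _

theorem exists_two_pow_mul_sum_ofDigitsTerm (d : ℕ → Fin 2) (n : ℕ) :
    ∃ a : ℕ, 2 ^ n * ∑ i ∈ Finset.range n, Real.ofDigitsTerm d i = a := by
  induction n with
  | zero => exact ⟨0, by simp⟩
  | succ n ih =>
    obtain ⟨a, ha⟩ := ih
    refine ⟨2 * a + d n, ?_⟩
    rw [Finset.sum_range_succ, mul_add, pow_succ', mul_assoc, ha, Real.ofDigitsTerm]
    push_cast
    field_simp
    ring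

-- Multiplying by `8 ^ m` moves the digits `x_m 0 1` just in front of the binary point, where they
-- contribute `4 * x_m + 1`. The tail `r` is an infinite expansion, so only the closed bound `r ≤ 1`
-- is claimed.
open Classical in
theorem exists_pow_mul_coinBias_eq (I : Set ℕ+) (m : ℕ+) :
    ∃ (a : ℕ) (r : ℝ), 0 ≤ r ∧ r ≤ 1 ∧
      8 ^ (m : ℕ) * coinBias I = 8 * a + 4 * (if m ∈ I then 1 else 0) + 1 + r := by
  obtain ⟨j, hj⟩ : ∃ j, (m : ℕ) = j + 1 := Nat.exists_eq_succ_of_ne_zero m.ne_zero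
  obtain ⟨a, ha⟩ := exists_two_pow_mul_sum_ofDigitsTerm (coinDigits I) (3 * j)
  refine ⟨a, Real.ofDigits (fun i => coinDigits I (i + (3 * j + 3))), Real.ofDigits_nonneg _,
    Real.ofDigits_le_one _, ?_⟩
  have hm : Nat.succPNat j = m := PNat.coe_injective (by simp [hj])
  have h0 : coinDigits I (3 * j) = if m ∈ I then 1 else 0 := by
    simp [coinDigits, hm]
  have h1 : coinDigits I (3 * j + 1) = 0 := by
    simp [coinDigits, show (3 * j + 1) % 3 = 1 by omega]
  have h2 : coinDigits I (3 * j + 2) = 1 := by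
    simp [coinDigits, show (3 * j + 2) % 3 = 2 by omega]
  rw [coinBias, Real.ofDigits_eq_sum_add_ofDigits _ (3 * j + 3), Finset.sum_range_succ,
    Finset.sum_range_succ, Finset.sum_range_succ, ← ha, hj]
  simp only [Real.ofDigitsTerm, h0, h1, h2]
  have h8 : (8 : ℝ) ^ (j + 1) = 8 * 2 ^ (3 * j) := by
    rw [pow_succ', pow_mul]; norm_num
  rw [h8]
  split_ifs <;> push_cast <;> field_simp <;> simp [pow_succ] <;> ring

/-- The mean is `8 ^ m * (8 * a + 4 * x + 1 + r)`. A deviation below `8 ^ m` keeps `h / 8 ^ m`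
between `8 * a + 4 * x` and `8 * a + 4 * x + 2`, and all these values agree in the bit of weight
`4`. -/
theorem testBit_eq_of_abs_sub_lt {p : ℝ} {m a x h : ℕ} {r : ℝ} (hx : x ≤ 1) (hr0 : 0 ≤ r)
    (hr1 : r ≤ 1) (hp : 8 ^ m * p = 8 * a + 4 * x + 1 + r)
    (hdev : |((64 ^ m : ℕ) : ℝ) * p - h| < 8 ^ m) : h.testBit (3 * m + 2) = decide (x = 1) := by
  have h8 : (0 : ℝ) < 8 ^ m := by positivity
  have h64 : ((64 ^ m : ℕ) : ℝ) * p = 8 ^ m * (8 * a + 4 * x + 1 + r) := by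
    rw [← hp, ← mul_assoc, ← mul_pow]; norm_num
  rw [h64, abs_lt] at hdev
  have hlo : 8 ^ m * (8 * a + 4 * x) ≤ h := by
    have : (8 : ℝ) ^ m * (8 * a + 4 * x) ≤ h := by nlinarith
    exact_mod_cast this
  have hhi : h < 8 ^ m * (8 * a + 4 * x + 3) := by
    have : (h : ℝ) < 8 ^ m * (8 * a + 4 * x + 3) := by nlinarith
    exact_mod_cast this
  have hq1 : 8 * a + 4 * x ≤ h / 8 ^ m := by
    rw [Nat.le_div_iff_mul_le (by positivity), mul_comm]; exact hlo
  have hq2 : h / 8 ^ m < 8 * a + 4 * x + 3 := by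
    rw [Nat.div_lt_iff_lt_mul (by positivity), mul_comm]; exact hhi
  rw [Nat.testBit_eq_decide_div_mod_eq, show 2 ^ (3 * m + 2) = 8 ^ m * 4 by
    rw [pow_add, pow_mul]; norm_num, ← Nat.div_div_eq_div_mul]
  congr 1
  rw [eq_iff_iff]
  omega

theorem headCountBitProb_of_mem {I : Set ℕ+} {m : ℕ+} (hm : m ∈ I) :
    3 / 4 ≤ headCountBitProb (coinBias I) (64 ^ (m : ℕ)) (3 * (m : ℕ) + 2) := by
  obtain ⟨a, r, hr0, hr1, h⟩ := exists_pow_mul_coinBias_eq I m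
  have h1 := sum_choose_mul_pow_of_deviation_le (coinBias_nonneg I) (coinBias_le_one I)
    (N := 64 ^ (m : ℕ)) (t := 8 ^ (m : ℕ)) (by positivity)
    (by push_cast; rw [← pow_mul, mul_comm, pow_mul]; norm_num)
    ((Finset.range (64 ^ (m : ℕ) + 1)).filter fun h => ¬ h.testBit (3 * (m : ℕ) + 2) = true)
    (Finset.filter_subset _ _) (fun j hj => by
      by_contra! hdev
      have := testBit_eq_of_abs_sub_lt (x := 1) le_rfl hr0 hr1 (by simpa [hm] using h) hdev
      exact (Finset.mem_filter.1 hj).2 (by simpa using this))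
  have h2 := Finset.sum_filter_add_sum_filter_not (Finset.range (64 ^ (m : ℕ) + 1))
    (fun h => h.testBit (3 * (m : ℕ) + 2) = true)
    (fun h => ((64 ^ (m : ℕ)).choose h : ℝ) * coinBias I ^ h *
      (1 - coinBias I) ^ (64 ^ (m : ℕ) - h))
  rw [sum_choose_mul_pow] at h2
  rw [headCountBitProb]
  linarith

theorem headCountBitProb_of_notMem {I : Set ℕ+} {m : ℕ+} (hm : m ∉ I) :
    headCountBitProb (coinBias I) (64 ^ (m : ℕ)) (3 * (m : ℕ) + 2) ≤ 1 / 4 := by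
  obtain ⟨a, r, hr0, hr1, h⟩ := exists_pow_mul_coinBias_eq I m
  refine sum_choose_mul_pow_of_deviation_le (coinBias_nonneg I) (coinBias_le_one I)
    (t := 8 ^ (m : ℕ)) (by positivity)
    (by push_cast; rw [← pow_mul, mul_comm, pow_mul]; norm_num) _
    (Finset.filter_subset _ _) (fun j hj => ?_)
  by_contra! hdev
  have := testBit_eq_of_abs_sub_lt (x := 0) (by norm_num) hr0 hr1 (by simpa [hm] using h) hdev
  rw [(Finset.mem_filter.1 hj).2] at this
  simp at this

end Chebyshev

/-! ### The machine, and the arithmetic performed by one scan of its work tape -/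

namespace DivisorSearch

/-- The work tape stores three numbers, least significant digits first: the modulus (in base `64`),
a counter (in base `64`) and the number of heads (in base `8`, truncated). -/
abbrev Cell : Type := Fin 64 × Fin 64 × Fin 8

/-- The outcome of a scan of the work tape: whether the modulus equals the counter, whether the
modulus is a power of `64`, and the leading bit of the last digit of the number of heads. -/
structure Verdict where
  eq : Bool
  pow : Bool
  top : Bool

/-- The finite memory during a scan of the work tape. -/
structure Scan where
  reset : Bool
  carryK : Bool
  carryC : Bool
  carryH : Bool
  eq : Bool
  zero : Bool
  pow : Bool
  top : Bool

/-- The phases of the computation. -/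
inductive Mode where
  | rewind
  | first
  | sweep
  | toss

/-- The states of the machine. -/
inductive State where
  | control (m : Mode) (v : Verdict)
  | scan (m : Mode) (p : Scan)
  | back (m : Mode) (v : Verdict)
  | accept
  | reject

instance : Finite Verdict :=
  Finite.of_injective (fun v => (v.eq, v.pow, v.top)) fun v v' h => by
    cases v; cases v'; simp_all

instance : Finite Scan :=
  Finite.of_injective (fun p => (p.reset, p.carryK, p.carryC, p.carryH, p.eq, p.zero, p.pow, p.top))
    fun p p' h => by cases p; cases p'; simp_all

instance : Finite Mode :=
  Finite.of_injective
    (fun m => match m with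
      | .rewind => (0 : Fin 4)
      | .first => 1
      | .sweep => 2
      | .toss => 3) fun m m' h => by cases m <;> cases m' <;> simp_all

instance : Finite State :=
  Finite.of_surjective
    (fun x : ((Mode × Verdict) ⊕ (Mode × Scan)) ⊕ ((Mode × Verdict) ⊕ Bool) => match x with
      | .inl (.inl (m, v)) => State.control m v
      | .inl (.inr (m, p)) => State.scan m p
      | .inr (.inl (m, v)) => State.back m v
      | .inr (.inr true) => State.accept
      | .inr (.inr false) => State.reject) fun s => by
    cases s with
    | control m v => exact ⟨.inl (.inl (m, v)), rfl⟩
    | scan m p => exact ⟨.inl (.inr (m, p)), rfl⟩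
    | back m v => exact ⟨.inr (.inl (m, v)), rfl⟩
    | accept => exact ⟨.inr (.inr true), rfl⟩
    | reject => exact ⟨.inr (.inr false), rfl⟩

/-- The memory at the start of a scan that adds `a`, `b`, `d` to the modulus, the counter and the
number of heads, where the counter is first set to `0` if `r` holds. -/
def Scan.begin (r a b d : Bool) : Scan := ⟨r, a, b, d, true, true, false, false⟩

/-- The processing of one cell. -/
def scanCell (p : Scan) (x : Cell) : Scan × Cell :=
  let k := x.1.val + p.carryK.toNat
  let c := (if p.reset then 0 else x.2.1.val) + p.carryC.toNat
  let h := x.2.2.val + p.carryH.toNat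
  (⟨p.reset, decide (64 ≤ k), decide (64 ≤ c), decide (8 ≤ h), p.eq && decide (k % 64 = c % 64),
    p.zero && decide (k % 64 = 0), p.zero && decide (k % 64 = 1), decide (4 ≤ h % 8)⟩,
    (Fin.ofNat 64 k, Fin.ofNat 64 c, Fin.ofNat 8 h))

/-- The end of a scan, with the cell that is appended if the modulus overflows. -/
def scanEnd (p : Scan) : Verdict × Option Cell :=
  if p.carryK then (⟨p.eq && p.carryC, p.zero, false⟩, some (1, Fin.ofNat 64 p.carryC.toNat, 0))
  else (⟨p.eq, p.pow, p.top⟩, none)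

/-- The processing of a list of cells. -/
def scanList (p : Scan) : List Cell → Scan × List Cell
  | [] => (p, [])
  | x :: l => ((scanList (scanCell p x).1 l).1, (scanCell p x).2 :: (scanList (scanCell p x).1 l).2)

/-- The decision taken between two scans, given the outcome `b` of a coin toss. -/
def control (b : Bool) (m : Mode) (v : Verdict) (σ : InputSymbol Unit) : State × HeadMove :=
  match m, σ with
  | .rewind, .leftEnd => (.scan .first (.begin false false false false), .right)
  | .rewind, _ => (.scan .rewind (.begin false false false false), .left)
  | .first, .letter _ => (.scan .sweep (.begin true true true false), .right)
  | .first, _ => (.reject, .stay)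
  | .sweep, .letter _ => (.scan .sweep (.begin v.eq false true false), .right)
  | .sweep, .rightEnd =>
    if v.eq then (.scan .rewind (.begin false false false false), .left)
    else if v.pow then (.scan .toss (.begin true false false false), .stay)
    else (.reject, .stay)
  | .sweep, .leftEnd => (.reject, .stay)
  | .toss, _ =>
    if v.eq then (if v.top then .accept else .reject, .stay)
    else (.scan .toss (.begin false false true b), .stay)

/-- The transition of the machine, given the outcome `b` of a coin toss. -/
def transition (b : Bool) (s : State) (σ : InputSymbol Unit) (γ : Option Cell) :
    State × Option Cell × HeadMove × HeadMove :=
  match s, γ with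
  | .control m v, γ => ((control b m v σ).1, γ, (control b m v σ).2, .stay)
  | .scan m p, some x => (.scan m (scanCell p x).1, some (scanCell p x).2, .stay, .right)
  | .scan m p, none => (.back m (scanEnd p).1, (scanEnd p).2, .stay, .left)
  | .back m v, some x => (.back m v, some x, .stay, .left)
  | .back m v, none => (.control m v, none, .stay, .right)
  | s, γ => (s, γ, .stay, .stay)

theorem transition_leftEnd_ne_left (b : Bool) (s : State) (γ : Option Cell) :
    (transition b s .leftEnd γ).2.2.1 ≠ .left := by
  rcases s with ⟨m, v⟩ | _ | _ | _ | _ <;> rcases γ with _ | x <;>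
    first
    | (simp [transition]; done)
    | (cases m <;> simp only [transition, control] <;> (try split_ifs) <;> simp)

theorem transition_rightEnd_ne_right (b : Bool) (s : State) (γ : Option Cell) :
    (transition b s .rightEnd γ).2.2.1 ≠ .right := by
  rcases s with ⟨m, v⟩ | _ | _ | _ | _ <;> rcases γ with _ | x <;>
    first
    | (simp [transition]; done)
    | (cases m <;> simp only [transition, control] <;> (try split_ifs) <;> simp)

open scoped NNReal

/-- The machine that determines `F(n)`, tests whether it is a power `64 ^ m` with `m ≥ 1`, and if
so, tosses `64 ^ m` coins and outputs the bit of weight `2 ^ (3 * m + 2)` of the number of heads. -/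
noncomputable def machine (p : ℝ≥0) (hp : p ≤ 1) : PTM Unit where
  S := State
  Γ := Cell
  finite_S := inferInstance
  finite_Γ := inferInstance
  δ s σ γ := (coin p hp).map fun b => transition b s σ γ
  start := .control .rewind ⟨true, false, false⟩
  acc := .accept
  rej := .reject
  acc_ne_rej := nofun
  leftEnd_move s γ r hr := by
    obtain ⟨b, -, rfl⟩ := (PMF.mem_support_map_iff _ _ _).1 hr
    exact transition_leftEnd_ne_left b s γ
  rightEnd_move s γ r hr := by
    obtain ⟨b, -, rfl⟩ := (PMF.mem_support_map_iff _ _ _).1 hr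
    exact transition_rightEnd_ne_right b s γ

/-- Each transition is a function of a single toss, so an outcome is produced by both sides of the
coin, by exactly one, or by none. -/
theorem machine_δ_mem (p : ℝ≥0) (hp : p ≤ 1) (s : State) (σ : InputSymbol Unit) (γ : Option Cell)
    (r : State × Option Cell × HeadMove × HeadMove) :
    (machine p hp).δ s σ γ r ∈ ({0, 1, (p : ENNReal), ((1 - p : ℝ≥0) : ENNReal)} : Set ENNReal) := by
  change ((coin p hp).map fun b => transition b s σ γ) r ∈ _
  rw [PMF.map_apply, tsum_bool]
  have h : ((1 - p : ℝ≥0) : ENNReal) + p = 1 := by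
    rw [← ENNReal.coe_add, ENNReal.coe_eq_one]
    exact tsub_add_cancel_of_le hp
  split_ifs
  · right; left; simpa [coin] using h
  · right; right; right; simp [coin]
  · right; right; left; simp [coin]
  · left; simp

/-! ### The encoding of numbers -/

/-- The `n` least significant digits of three numbers. -/
def encode : ℕ → ℕ → ℕ → ℕ → List Cell
  | 0, _, _, _ => []
  | n + 1, k, c, h =>
    (Fin.ofNat 64 k, Fin.ofNat 64 c, Fin.ofNat 8 h) :: encode n (k / 64) (c / 64) (h / 8)

@[simp]
theorem length_encode (n k c h : ℕ) : (encode n k c h).length = n := by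
  induction n generalizing k c h with
  | zero => rfl
  | succ n ih => simp [encode, ih]

theorem encode_append (n k c h : ℕ) :
    encode n k c h ++ [(Fin.ofNat 64 (k / 64 ^ n), Fin.ofNat 64 (c / 64 ^ n),
      Fin.ofNat 8 (h / 8 ^ n))] = encode (n + 1) k c h := by
  induction n generalizing k c h with
  | zero => simp [encode]
  | succ n ih =>
    rw [encode, encode, List.cons_append, ← ih]
    simp only [pow_succ', Nat.div_div_eq_div_mul]

/-- The carry out of the lowest digit is what the quotient must absorb. Hence scanning the remaining
cells is again a scan of an encoded triple, with updated memory, and all `scanList_encode` lemmas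
follow by induction over the digits. -/
theorem div_add_carry {n : ℕ} (hn : 1 < n) (k : ℕ) (a : Bool) :
    k / n + (decide (n ≤ k % n + a.toNat)).toNat = (k + a.toNat) / n := by
  have hn0 : 0 < n := by omega
  rcases a with _ | _
  · simp [Nat.mod_lt k hn0]
  · rw [Nat.add_div hn0]
    simp [Nat.div_eq_of_lt hn, Nat.mod_eq_of_lt hn, Bool.toNat, Bool.cond_decide]

/-- The value of the counter after a scan. -/
def Scan.counter (p : Scan) (c : ℕ) : ℕ := (if p.reset then 0 else c) + p.carryC.toNat

/-- The memory after the least significant digits have been scanned. -/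
def Scan.tail (p : Scan) (k c h : ℕ) : Scan :=
  ⟨p.reset, decide (64 ≤ k % 64 + p.carryK.toNat),
    decide (64 ≤ (if p.reset then 0 else c % 64) + p.carryC.toNat),
    decide (8 ≤ h % 8 + p.carryH.toNat),
    p.eq && decide ((k + p.carryK.toNat) % 64 = p.counter c % 64),
    p.zero && decide ((k + p.carryK.toNat) % 64 = 0),
    p.zero && decide ((k + p.carryK.toNat) % 64 = 1),
    decide (4 ≤ (h + p.carryH.toNat) % 8)⟩

theorem ofNat_congr {n a b : ℕ} [NeZero n] (h : a % n = b % n) : Fin.ofNat n a = Fin.ofNat n b :=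
  Fin.ext h

theorem scanCell_encode (p : Scan) (k c h : ℕ) :
    scanCell p (Fin.ofNat 64 k, Fin.ofNat 64 c, Fin.ofNat 8 h) =
      (p.tail k c h, (Fin.ofNat 64 (k + p.carryK.toNat), Fin.ofNat 64 (p.counter c),
        Fin.ofNat 8 (h + p.carryH.toNat))) := by
  have hc : ((if p.reset then 0 else c % 64) + p.carryC.toNat) % 64 = p.counter c % 64 := by
    unfold Scan.counter; split_ifs <;> omega
  have hk : (k % 64 + p.carryK.toNat) % 64 = (k + p.carryK.toNat) % 64 := by omega
  have hh : (h % 8 + p.carryH.toNat) % 8 = (h + p.carryH.toNat) % 8 := by omega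
  simp only [scanCell, Scan.tail, Fin.val_ofNat, hc, hk, hh, ofNat_congr hc, ofNat_congr hk,
    ofNat_congr hh]

theorem tail_counter (p : Scan) (k c h : ℕ) :
    (p.tail k c h).counter (c / 64) = p.counter c / 64 := by
  rcases hr : p.reset with _ | _
  · simpa [Scan.counter, Scan.tail, hr] using div_add_carry (by norm_num) c p.carryC
  -- With the reset flag set, every old counter digit is read as `0`, so this is the carry rule for
  -- the number `0`.
  · simpa [Scan.counter, Scan.tail, hr] using div_add_carry (by norm_num : 1 < 64) 0 p.carryC

theorem tail_carryK (p : Scan) (k c h : ℕ) :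
    k / 64 + (p.tail k c h).carryK.toNat = (k + p.carryK.toNat) / 64 :=
  div_add_carry (by norm_num) k p.carryK

theorem tail_carryH (p : Scan) (k c h : ℕ) :
    h / 8 + (p.tail k c h).carryH.toNat = (h + p.carryH.toNat) / 8 :=
  div_add_carry (by norm_num) h p.carryH

theorem scanList_encode_snd (p : Scan) (n k c h : ℕ) :
    (scanList p (encode n k c h)).2 =
      encode n (k + p.carryK.toNat) (p.counter c) (h + p.carryH.toNat) := by
  induction n generalizing p k c h with
  | zero => rfl
  | succ n ih =>
    simp only [encode, scanList, scanCell_encode, ih, tail_counter, tail_carryK, tail_carryH]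

theorem mod_pow_succ_eq_iff {b : ℕ} (n x y : ℕ) :
    x % b ^ (n + 1) = y % b ^ (n + 1) ↔ x % b = y % b ∧ x / b % b ^ n = y / b % b ^ n := by
  rw [pow_succ', Nat.mod_mul, Nat.mod_mul]
  constructor
  · intro h
    rcases Nat.eq_zero_or_pos b with rfl | hb
    · simpa using h
    · have h1 := congrArg (· % b) h
      have h2 := congrArg (· / b) h
      simp only [Nat.add_mul_mod_self_left, Nat.mod_mod] at h1
      simp only [Nat.add_mul_div_left _ _ hb, Nat.div_eq_of_lt (Nat.mod_lt _ hb), zero_add] at h2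
      exact ⟨h1, h2⟩
  · rintro ⟨h1, h2⟩
    rw [h1, h2]

theorem scanList_encode_carryK (p : Scan) (n k c h : ℕ) (hk : k < 64 ^ n) :
    (scanList p (encode n k c h)).1.carryK = decide (64 ^ n ≤ k + p.carryK.toNat) := by
  induction n generalizing p k c h with
  | zero =>
    obtain rfl : k = 0 := by simpa using hk
    cases hp : p.carryK <;> simp [encode, scanList, hp]
  | succ n ih =>
    rw [encode, scanList, scanCell_encode, ih _ _ _ _ (by rw [pow_succ] at hk; omega), tail_carryK,
      decide_eq_decide, Nat.le_div_iff_mul_le (by norm_num), pow_succ]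

theorem scanList_encode_carryC (p : Scan) (n k c h : ℕ) (hc : c < 64 ^ n) :
    (scanList p (encode n k c h)).1.carryC = decide (64 ^ n ≤ p.counter c) := by
  induction n generalizing p k c h with
  | zero =>
    obtain rfl : c = 0 := by simpa using hc
    cases hp : p.carryC <;> simp [encode, scanList, Scan.counter, hp]
  | succ n ih =>
    rw [encode, scanList, scanCell_encode, ih _ _ _ _ (by rw [pow_succ] at hc; omega), tail_counter,
      decide_eq_decide, Nat.le_div_iff_mul_le (by norm_num), pow_succ]

theorem scanList_encode_eq (p : Scan) (n k c h : ℕ) :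
    (scanList p (encode n k c h)).1.eq =
      (p.eq && decide ((k + p.carryK.toNat) % 64 ^ n = p.counter c % 64 ^ n)) := by
  induction n generalizing p k c h with
  | zero => simp [encode, scanList, Nat.mod_one]
  | succ n ih =>
    rw [encode, scanList, scanCell_encode, ih, tail_carryK, tail_counter]
    simp only [mod_pow_succ_eq_iff, Scan.tail, Bool.decide_and, Bool.and_assoc]

theorem scanList_encode_zero (p : Scan) (n k c h : ℕ) :
    (scanList p (encode n k c h)).1.zero =
      (p.zero && decide ((k + p.carryK.toNat) % 64 ^ n = 0)) := by
  induction n generalizing p k c h with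
  | zero => simp [encode, scanList, Nat.mod_one]
  | succ n ih =>
    rw [encode, scanList, scanCell_encode, ih, tail_carryK]
    have := @mod_pow_succ_eq_iff 64 n (k + p.carryK.toNat) 0
    simp only [Nat.zero_mod, Nat.zero_div] at this
    simp only [this, Scan.tail, Bool.decide_and, Bool.and_assoc]

/-- The flag `pow` is overwritten in every cell, using the value of `zero` from the cells before.
Only the last cell counts: a leading digit `1` above zeros. This needs at least one cell, hence `n +
1`. -/
theorem scanList_encode_pow (p : Scan) (n k c h : ℕ) :
    (scanList p (encode (n + 1) k c h)).1.pow =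
      (p.zero && decide ((k + p.carryK.toNat) % 64 ^ (n + 1) = 64 ^ n)) := by
  induction n generalizing p k c h with
  | zero =>
    rw [encode, scanList, scanCell_encode]
    simp [encode, scanList, Scan.tail]
  | succ n ih =>
    rw [encode, scanList, scanCell_encode, ih, tail_carryK]
    have := @mod_pow_succ_eq_iff 64 (n + 1) (k + p.carryK.toNat) (64 ^ (n + 1))
    rw [Nat.mod_eq_of_lt (Nat.pow_lt_pow_right (by norm_num) (by omega)), pow_succ' 64 n,
      Nat.mul_mod_right, Nat.mul_div_cancel_left _ (by norm_num), ← pow_succ' 64 n,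
      Nat.mod_eq_of_lt (a := 64 ^ n) (Nat.pow_lt_pow_right (by norm_num) (by omega))] at this
    simp only [this, Scan.tail, Bool.decide_and, Bool.and_assoc]

theorem scanList_encode_top (p : Scan) (n k c h : ℕ) :
    (scanList p (encode (n + 1) k c h)).1.top =
      decide (4 ≤ (h + p.carryH.toNat) / 8 ^ n % 8) := by
  induction n generalizing p k c h with
  | zero =>
    rw [encode, scanList, scanCell_encode]
    simp [encode, scanList, Scan.tail]
  | succ n ih =>
    rw [encode, scanList, scanCell_encode, ih, tail_carryH, Nat.div_div_eq_div_mul, ← pow_succ']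

/-- The number of digits of `k` in base `64`. -/
def width (k : ℕ) : ℕ := Nat.clog 64 (k + 1)

theorem lt_pow_width (k : ℕ) : k < 64 ^ width k := Nat.le_pow_clog (by norm_num) (k + 1)

theorem pow_width_le {k n : ℕ} (hk : width k = n + 1) : 64 ^ n ≤ k :=
  Nat.lt_succ_iff.1 (Nat.pow_lt_of_lt_clog (b := 64) (show n < Nat.clog 64 (k + 1) by
    rw [← width]; omega))

theorem width_mono {k l : ℕ} (h : k ≤ l) : width k ≤ width l :=
  Nat.clog_mono_right 64 (Nat.succ_le_succ h)

theorem width_eq {k n : ℕ} (h1 : 64 ^ n ≤ k) (h2 : k < 64 ^ (n + 1)) : width k = n + 1 :=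
  le_antisymm (Nat.clog_le_of_le_pow h2)
    ((Nat.lt_clog_iff_pow_lt (by norm_num)).2 (Nat.lt_succ_iff.2 h1))

theorem width_zero : width 0 = 0 := by simp [width]

theorem width_pos {k : ℕ} (hk : 0 < k) : 0 < width k := Nat.clog_pos (by norm_num) (by omega)

theorem width_le (k : ℕ) : width k ≤ k :=
  Nat.clog_le_of_le_pow (Nat.succ_le_of_lt (Nat.lt_pow_self (by norm_num)))

theorem width_pow (m : ℕ) : width (64 ^ m) = m + 1 :=
  width_eq le_rfl (Nat.pow_lt_pow_right (by norm_num) (by omega))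

/-- The contents of the work tape. -/
def tape (k c h : ℕ) : List Cell := encode (width k) k c h

/-- The correct outcome of a scan. -/
def verdict (k c h : ℕ) : Verdict :=
  ⟨decide (k = c), decide (k = 64 ^ (width k - 1)), decide (4 ≤ h / 8 ^ (width k - 1) % 8)⟩

theorem verdict_pow_iff {k c h : ℕ} : (verdict k c h).pow = true ↔ ∃ m, k = 64 ^ m := by
  simp only [verdict, decide_eq_true_eq]
  refine ⟨fun hk => ⟨_, hk⟩, ?_⟩
  rintro ⟨m, rfl⟩
  rw [width_pow, Nat.add_sub_cancel]

theorem verdict_top (m c h : ℕ) : (verdict (64 ^ m) c h).top = h.testBit (3 * m + 2) := by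
  rw [verdict, width_pow, Nat.add_sub_cancel, Nat.testBit_eq_decide_div_mod_eq,
    show 2 ^ (3 * m + 2) = 8 ^ m * 4 by rw [pow_add, pow_mul]; norm_num, ← Nat.div_div_eq_div_mul]
  exact decide_eq_decide.2 (by omega)

/-- The outcome of a scan of a list, and the list after the scan. -/
def scanFull (p : Scan) (l : List Cell) : Verdict × List Cell :=
  ((scanEnd (scanList p l).1).1, (scanList p l).2 ++ (scanEnd (scanList p l).1).2.toList)

/-- The modulus is unchanged, so nothing overflows on its track. The bound on the new counter makes
it fit into the same width, which turns the digitwise comparison modulo `64 ^ width k` into genuine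
equality. The heads may be truncated, since the verdict uses only their top stored digit. -/
theorem scanFull_tape {k c h : ℕ} {r b d : Bool} (hk : 0 < k)
    (hc' : (if r then 0 else c) + b.toNat ≤ k) :
    scanFull (.begin r false b d) (tape k c h) =
      (verdict k ((if r then 0 else c) + b.toNat) (h + d.toNat),
        tape k ((if r then 0 else c) + b.toNat) (h + d.toNat)) := by
  obtain ⟨n, hn⟩ := Nat.exists_eq_succ_of_ne_zero (width_pos hk).ne'
  have hlt := lt_pow_width k
  have hcounter : (Scan.begin r false b d).counter c = (if r then 0 else c) + b.toNat := rfl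
  have hcarry : (scanList (.begin r false b d) (tape k c h)).1.carryK = false := by
    rw [tape, scanList_encode_carryK _ _ _ _ _ hlt]
    simpa [Scan.begin] using hlt
  rw [scanFull, scanEnd, hcarry, tape, scanList_encode_snd, scanList_encode_eq]
  rw [hn, scanList_encode_pow, scanList_encode_top, hcounter, ← Nat.succ_eq_add_one, ← hn]
  simp only [verdict, hn]
  rw [hn] at hlt
  simp [Scan.begin, Nat.mod_eq_of_lt hlt, Nat.mod_eq_of_lt (hc'.trans_lt hlt), tape, hn]
  exact decide_eq_decide.2 Iff.rfl

/-- The only kind of scan that can lengthen the tape. Overflow happens exactly when `k + 1` is a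
power of `64`: all old digits become `0` and the appended digit is `1`. The case `k = 0` is the
empty tape, where the counter overflows too. -/
theorem scanFull_tape_succ {k c : ℕ} (hc : c ≤ k) :
    scanFull (.begin true true true false) (tape k c 0) =
      (verdict (k + 1) 1 0, tape (k + 1) 1 0) := by
  have hlt := lt_pow_width k
  have hcarryK : (scanList (.begin true true true false) (tape k c 0)).1.carryK =
      decide (64 ^ width k ≤ k + 1) := by
    rw [tape, scanList_encode_carryK _ _ _ _ _ hlt]; rfl
  have hcarryC : (scanList (.begin true true true false) (tape k c 0)).1.carryC =
      decide (64 ^ width k ≤ 1) := by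
    rw [tape, scanList_encode_carryC _ _ _ _ _ (hc.trans_lt hlt)]; rfl
  have hsnd : (scanList (.begin true true true false) (tape k c 0)).2 =
      encode (width k) (k + 1) 1 0 := by
    rw [tape, scanList_encode_snd]; rfl
  have heq : (scanList (.begin true true true false) (tape k c 0)).1.eq =
      decide ((k + 1) % 64 ^ width k = 1 % 64 ^ width k) := by
    rw [tape, scanList_encode_eq]; rfl
  rcases Nat.lt_or_ge (k + 1) (64 ^ width k) with h | h
  · have hk : 0 < k := by
      rcases Nat.eq_zero_or_pos k with rfl | hk
      · simp [width_zero] at h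
      · exact hk
    obtain ⟨n, hn⟩ := Nat.exists_eq_succ_of_ne_zero (width_pos hk).ne'
    have hw : width (k + 1) = n + 1 :=
      width_eq ((pow_width_le hn).trans k.le_succ) (by rwa [hn] at h)
    have hpow : (scanList (.begin true true true false) (tape k c 0)).1.pow =
        decide (k + 1 = 64 ^ n) := by
      rw [tape, hn, scanList_encode_pow]
      rw [hn] at h
      simp [Scan.begin, Nat.mod_eq_of_lt h]
    have htop : (scanList (.begin true true true false) (tape k c 0)).1.top = false := by
      rw [tape, hn, scanList_encode_top]
      simp [Scan.begin]
    rw [scanFull, scanEnd, hcarryK, decide_eq_false (not_le.2 h), hsnd, heq, hpow, htop, Nat.mod_eq_of_lt h,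
      Nat.mod_eq_of_lt (show 1 < 64 ^ width k by omega)]
    simp [verdict, hw, tape, hn]
  · have hk : k + 1 = 64 ^ width k := by omega
    have hw : width (k + 1) = width k + 1 := by
      conv_lhs => rw [hk]
      exact width_pow _
    have hzero : (scanList (.begin true true true false) (tape k c 0)).1.zero = true := by
      rw [tape, scanList_encode_zero]
      simp [Scan.begin, ← hk]
    have htape : tape (k + 1) 1 0 = encode (width k) (k + 1) 1 0 ++
        [(1, Fin.ofNat 64 (1 / (k + 1)), 0)] := by
      rw [tape, hw, ← encode_append, ← hk, Nat.div_self k.succ_pos]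
      simp; rfl
    rw [scanFull, scanEnd, hcarryK, hcarryC, hsnd, heq, hzero, htape]
    simp only [verdict, hw, ← hk]
    rcases Nat.eq_zero_or_pos k with rfl | hk0
    · simpa using hk
    · have : 1 / (k + 1) = 0 := Nat.div_eq_of_lt (by omega)
      simpa [this, hk0.ne', Nat.mod_eq_of_lt (show 1 < k + 1 by omega)] using hk

end DivisorSearch

/-! ### The deterministic search, step by step on the tape -/

namespace DivisorSearch

open scoped NNReal
open PTM

/-- The work tape that holds the list `l` in the cells `0, …, l.length - 1`. -/
def tapeOf (l : List Cell) (z : ℤ) : Option Cell := if 0 ≤ z then l[z.toNat]? else none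

theorem tapeOf_nil : tapeOf [] = fun _ => none := by
  funext z; simp [tapeOf]

theorem tapeOf_neg_one (l : List Cell) : tapeOf l (-1) = none := by simp [tapeOf]

theorem tapeOf_natCast (l : List Cell) (j : ℕ) : tapeOf l j = l[j]? := by simp [tapeOf]

theorem update_tapeOf_append (l l' : List Cell) (x y : Cell) :
    Function.update (tapeOf (l ++ x :: l')) l.length (some y) = tapeOf (l ++ y :: l') := by
  funext z
  by_cases hz : z = l.length
  · subst hz
    simp [tapeOf_natCast]
  · rw [Function.update_of_ne hz]
    unfold tapeOf
    split_ifs with h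
    · obtain ⟨j, rfl⟩ := Int.eq_ofNat_of_zero_le h
      have hj : j ≠ l.length := by simpa using hz
      simp only [Int.toNat_natCast, List.getElem?_append, List.getElem?_cons]
      split_ifs <;> first | rfl | omega
    · rfl

theorem update_tapeOf_length (l : List Cell) (o : Option Cell) :
    Function.update (tapeOf l) l.length o = tapeOf (l ++ o.toList) := by
  funext z
  by_cases hz : z = l.length
  · subst hz
    cases o <;> simp [tapeOf_natCast]
  · rw [Function.update_of_ne hz]
    unfold tapeOf
    split_ifs with h
    · obtain ⟨j, rfl⟩ := Int.eq_ofNat_of_zero_le h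
      have hj : j ≠ l.length := by simpa using hz
      cases o with
      | none => simp
      | some y =>
        simp only [Int.toNat_natCast, List.getElem?_append, Option.toList_some]
        split_ifs
        · rfl
        · rw [List.getElem?_eq_none (by omega), List.getElem?_eq_none (by simp; omega)]
    · rfl

theorem length_tape (k c h : ℕ) : (tape k c h).length = width k := length_encode _ _ _ _

/-- The cells that the machine may visit while the modulus has at most `N` digits. -/
noncomputable def cells (N : ℕ) : Finset ℤ := Finset.Icc (-1) N

variable (p : ℝ≥0) (hp : p ≤ 1) (N : ℕ)

/-- A configuration in which exactly the cells in `cells N` have been visited. -/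
noncomputable def config (s : State) (i : ℕ) (T : ℤ → Option Cell) (z : ℤ) : (machine p hp).Config :=
  ⟨s, i, T, z, cells N⟩

variable {p hp N} {w : List Unit}

theorem next_config {s : State} {i : ℕ} {T : ℤ → Option Cell} {z : ℤ}
    (r : State × Option Cell × HeadMove × HeadMove) (hz : moveWork r.2.2.2 z ∈ cells N) :
    (machine p hp).next (config p hp N s i T z) r =
      config p hp N r.1 (moveInput r.2.2.1 i) (Function.update T z r.2.1)
        (moveWork r.2.2.2 z) := by
  simp only [next, config, Finset.insert_eq_of_mem hz]
  rfl

/-- The transition function tosses a coin in every step; the step is deterministic when both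
outcomes lead to the same result `r`. -/
theorem detStep_config {s : State} {i : ℕ} {T : ℤ → Option Cell} {z : ℤ}
    (r : State × Option Cell × HeadMove × HeadMove) (hs : s ≠ .accept) (hs' : s ≠ .reject)
    (h : ∀ b, transition b s (inputSymbol w i) (T z) = r) (hz : moveWork r.2.2.2 z ∈ cells N) :
    (machine p hp).DetStep w (config p hp N s i T z)
      (config p hp N r.1 (moveInput r.2.2.1 i) (Function.update T z r.2.1)
        (moveWork r.2.2.2 z)) := by
  refine ⟨fun hh => hh.elim hs hs', r, ?_, (next_config r hz).symm⟩
  change (coin p hp).map (fun b => transition b s (inputSymbol w i) (T z)) = _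
  simp only [h]
  exact PMF.map_const _ _

/-- Induction over the cells still to be scanned, with `pre` collecting the cells already rewritten.
-/
theorem detRun_scan (m : Mode) (i : ℕ) (l pre : List Cell) (q : Scan)
    (hN : pre.length + l.length ≤ N) :
    (machine p hp).DetRun w l.length (config p hp N (.scan m q) i (tapeOf (pre ++ l)) pre.length)
      (config p hp N (.scan m (scanList q l).1) i (tapeOf (pre ++ (scanList q l).2))
        (pre.length + l.length : ℕ)) := by
  induction l generalizing pre q with
  | nil => simpa [scanList] using DetRun.refl _
  | cons x l ih =>
    have hlen : pre.length + l.length + 1 ≤ N := by simpa [add_assoc] using hN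
    have h1 := detStep_config (p := p) (hp := hp) (N := N) (w := w) (s := .scan m q) (i := i)
      (T := tapeOf (pre ++ x :: l)) (z := pre.length)
      (.scan m (scanCell q x).1, some (scanCell q x).2, .stay, .right) nofun nofun
      (fun b => by simp [tapeOf_natCast, transition])
      (by simp only [moveWork, cells, Finset.mem_Icc]; omega)
    rw [update_tapeOf_append] at h1
    have h2 := ih (pre ++ [(scanCell q x).2]) (scanCell q x).1 (by simp; omega)
    refine .head h1 ?_
    convert! h2 using 2
    · simp
    · simp [moveWork]
    · simp [scanList]
    · simp; omega

theorem detRun_back (m : Mode) (v : Verdict) (i : ℕ) (l : List Cell) (j : ℕ) (hj : j ≤ l.length)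
    (hN : j ≤ N) :
    (machine p hp).DetRun w (j + 1) (config p hp N (.back m v) i (tapeOf l) ((j : ℤ) - 1))
      (config p hp N (.control m v) i (tapeOf l) 0) := by
  induction j with
  -- Here the head is on the blank cell `-1`, which marks the left end of the stored numbers and
  -- sends it back to cell `0`.
  | zero =>
    have h1 := detStep_config (p := p) (hp := hp) (N := N) (w := w) (s := .back m v) (i := i)
      (T := tapeOf l) (z := -1) (.control m v, none, .stay, .right) nofun nofun
      (fun b => by simp [tapeOf_neg_one, transition])
      (by simp [moveWork, cells])
    rw [← tapeOf_neg_one l, Function.update_eq_self] at h1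
    exact h1.detRun
  | succ j ih =>
    have h1 := detStep_config (p := p) (hp := hp) (N := N) (w := w) (s := .back m v) (i := i)
      (T := tapeOf l) (z := j) (.back m v, some l[j], .stay, .left) nofun nofun
      (fun b => by rw [tapeOf_natCast, List.getElem?_eq_getElem hj, transition])
      (by simp only [moveWork, cells, Finset.mem_Icc]; omega)
    rw [← List.getElem?_eq_getElem hj, ← tapeOf_natCast, Function.update_eq_self] at h1
    refine .head (d := config p hp N (.back m v) i (tapeOf l) ((j : ℤ) - 1)) ?_
      (ih (by omega) (by omega))
    simpa [moveWork, moveInput] using h1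

theorem detRun_scanFull (m : Mode) (q : Scan) (i : ℕ) (l : List Cell) (hN : l.length ≤ N) :
    (machine p hp).DetRun w (2 * l.length + 2) (config p hp N (.scan m q) i (tapeOf l) 0)
      (config p hp N (.control m (scanFull q l).1) i (tapeOf (scanFull q l).2) 0) := by
  have h1 := detRun_scan (p := p) (hp := hp) (w := w) m i l [] q (by simpa using hN)
  have hlen : ∀ (q : Scan) (l : List Cell), (scanList q l).2.length = l.length := by
    intro q l
    induction l generalizing q with
    | nil => rfl
    | cons x l ih => simp [scanList, ih]
  have h2 := detStep_config (p := p) (hp := hp) (N := N) (w := w) (s := .scan m (scanList q l).1)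
    (i := i) (T := tapeOf (scanList q l).2) (z := (scanList q l).2.length)
    (.back m (scanFull q l).1, (scanEnd (scanList q l).1).2, .stay, .left) nofun nofun
    (fun b => by simp [tapeOf_natCast, transition, scanFull])
    (by simp only [moveWork, cells, Finset.mem_Icc, hlen]; omega)
  rw [update_tapeOf_length] at h2
  -- The return starts at cell `l.length - 1` even if a cell was appended, because the head moves
  -- left off the cell it has just written.
  have h3 := detRun_back (p := p) (hp := hp) (N := N) (w := w) m (scanFull q l).1 i (scanFull q l).2
    l.length (by simp [scanFull, hlen]) hN
  have h2' : (machine p hp).DetStep w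
      (config p hp N (.scan m (scanList q l).1) i (tapeOf (scanList q l).2) l.length)
      (config p hp N (.back m (scanFull q l).1) i (tapeOf (scanFull q l).2) ((l.length : ℤ) - 1)) := by
    simpa [hlen, moveInput, moveWork, scanFull] using h2
  have h1' : (machine p hp).DetRun w l.length (config p hp N (.scan m q) i (tapeOf l) 0)
      (config p hp N (.scan m (scanList q l).1) i (tapeOf (scanList q l).2) l.length) := by
    simpa using h1
  have := h1'.trans (h2'.detRun.trans h3)
  rwa [show l.length + (1 + (l.length + 1)) = 2 * l.length + 2 by ring] at this

theorem detStep_control {m : Mode} {v : Verdict} {i : ℕ} {T : ℤ → Option Cell} {s : State}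
    {mv : HeadMove} (h : ∀ b, control b m v (inputSymbol w i) = (s, mv)) :
    (machine p hp).DetStep w (config p hp N (.control m v) i T 0)
      (config p hp N s (moveInput mv i) T 0) := by
  have h1 := detStep_config (p := p) (hp := hp) (N := N) (w := w) (s := .control m v) (i := i)
    (T := T) (z := 0) (s, T 0, mv, .stay) nofun nofun (fun b => by simp [transition, h])
    (by simp [moveWork, cells])
  rwa [Function.update_eq_self] at h1

theorem detRun_round {m m' : Mode} {v : Verdict} {i : ℕ} {l : List Cell} {q : Scan}
    {mv : HeadMove} (h : ∀ b, control b m v (inputSymbol w i) = (.scan m' q, mv))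
    (hN : l.length ≤ N) :
    (machine p hp).DetRun w (2 * l.length + 3) (config p hp N (.control m v) i (tapeOf l) 0)
      (config p hp N (.control m' (scanFull q l).1) (moveInput mv i) (tapeOf (scanFull q l).2) 0) :=
  .head (detStep_control h) (detRun_scanFull m' q _ l hN)

variable (p hp N) in
/-- A configuration between two scans that stores the numbers `k`, `c`, `h`. -/
noncomputable def rest (m : Mode) (v : Verdict) (i k c h : ℕ) : (machine p hp).Config :=
  config p hp N (.control m v) i (tapeOf (tape k c h)) 0

theorem detRun_rest {m m' : Mode} {v : Verdict} {i k c h : ℕ} {r b d : Bool} {mv : HeadMove}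
    (hctl : ∀ b', control b' m v (inputSymbol w i) = (.scan m' (.begin r false b d), mv))
    (hk : 0 < k) (hc : (if r then 0 else c) + b.toNat ≤ k) (hN : width k ≤ N) :
    (machine p hp).DetRun w (2 * width k + 3) (rest p hp N m v i k c h)
      (rest p hp N m' (verdict k ((if r then 0 else c) + b.toNat) (h + d.toNat)) (moveInput mv i) k
        ((if r then 0 else c) + b.toNat) (h + d.toNat)) := by
  have h1 := detRun_round (p := p) (hp := hp) (N := N) (l := tape k c h) hctl (by rwa [length_tape])
  rw [scanFull_tape hk hc] at h1
  rwa [length_tape] at h1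

theorem detRun_rest_succ {v : Verdict} {i k c : ℕ} (hctl : ∀ b',
      control b' .first v (inputSymbol w i) = (.scan .sweep (.begin true true true false), .right))
    (hc : c ≤ k) (hN : width k ≤ N) :
    (machine p hp).DetRun w (2 * width k + 3) (rest p hp N .first v i k c 0)
      (rest p hp N .sweep (verdict (k + 1) 1 0) (i + 1) (k + 1) 1 0) := by
  have h1 := detRun_round (p := p) (hp := hp) (N := N) (l := tape k c 0) hctl (by rwa [length_tape])
  rw [scanFull_tape_succ hc] at h1
  rwa [length_tape] at h1

theorem inputSymbol_letter {n i : ℕ} (hi : i < n) :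
    inputSymbol (List.replicate n ()) (i + 1) = .letter () := by
  simp [inputSymbol, hi]

theorem inputSymbol_rightEnd (n : ℕ) :
    inputSymbol (List.replicate n ()) (n + 1) = .rightEnd := by
  simp [inputSymbol]

/-- In this mode the verdict is ignored, so its final value may be left existential. The scans on
the way change none of the numbers. -/
theorem detRun_rewind {n i k c h : ℕ} {v : Verdict} (hk : 0 < k) (hc : c ≤ k)
    (hN : width k ≤ N) :
    ∃ v', (machine p hp).DetRun (List.replicate n ()) (i * (2 * width k + 3))
      (rest p hp N .rewind v i k c h) (rest p hp N .rewind v' 0 k c h) := by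
  induction i generalizing v with
  | zero => exact ⟨v, by simpa using DetRun.refl _⟩
  | succ i ih =>
    have h1 := detRun_rest (p := p) (hp := hp) (N := N) (w := List.replicate n ()) (m := .rewind)
      (m' := .rewind) (v := v) (i := i + 1) (k := k) (c := c) (h := h) (r := false) (b := false)
      (d := false) (mv := .left) (fun b => by
        rcases hs : inputSymbol (List.replicate n ()) (i + 1) with _ | _ | _
        · simp only [inputSymbol] at hs
          split at hs <;> simp at hs
        · rfl
        · rfl) hk (by simpa using hc) hN
    simp only [Bool.toNat_false, add_zero, Bool.false_eq_true, if_false, moveInput,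
      Nat.add_sub_cancel] at h1
    obtain ⟨v', hv'⟩ := ih (v := verdict k c h)
    refine ⟨v', ?_⟩
    rw [Nat.succ_mul, Nat.add_comm]
    exact h1.trans hv'

/-- With the head on cell `j + 2`, `j + 1` letters have been counted. The counter cycles through `1,
…, k`, restarting after it has reached `k`, which explains the shifted residue `j % k + 1`. -/
theorem detRun_sweep {n k j : ℕ} (hk : 0 < k) (hN : width k ≤ N) (hj : j < n) :
    (machine p hp).DetRun (List.replicate n ()) (j * (2 * width k + 3))
      (rest p hp N .sweep (verdict k 1 0) 2 k 1 0)
      (rest p hp N .sweep (verdict k (j % k + 1) 0) (j + 2) k (j % k + 1) 0) := by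
  induction j with
  | zero => simpa using DetRun.refl _
  | succ j ih =>
    have hlt := Nat.mod_lt j hk
    have hval : (if (verdict k (j % k + 1) 0).eq then 0 else j % k + 1) + true.toNat =
        (j + 1) % k + 1 := by
      simp only [verdict, decide_eq_true_eq, Bool.toNat_true]
      rw [Nat.add_mod j 1 k]
      split_ifs with h
      · rcases Nat.lt_or_ge 1 k with h1 | h1
        · rw [Nat.mod_eq_of_lt h1, ← h, Nat.mod_self]
        · obtain rfl : k = 1 := by omega
          simp [Nat.mod_one]
      · rw [Nat.mod_eq_of_lt (show 1 < k by omega), Nat.mod_eq_of_lt (show j % k + 1 < k by omega)]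
    have h1 := detRun_rest (p := p) (hp := hp) (N := N) (w := List.replicate n ()) (m := .sweep)
      (m' := .sweep) (v := verdict k (j % k + 1) 0) (i := j + 2) (k := k) (c := j % k + 1)
      (h := 0) (r := (verdict k (j % k + 1) 0).eq) (b := true) (d := false) (mv := .right)
      (fun b => by rw [inputSymbol_letter hj]; rfl) hk
      (by rw [hval]; exact Nat.mod_lt _ hk) hN
    rw [hval] at h1
    rw [Nat.succ_mul]
    exact (ih (by omega)).trans h1

theorem verdict_eq_mod_iff {n k h : ℕ} (hn : 0 < n) (hk : 0 < k) :
    (verdict k ((n - 1) % k + 1) h).eq = true ↔ k ∣ n := by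
  obtain ⟨j, rfl⟩ : ∃ j, n = j + 1 := ⟨n - 1, by omega⟩
  simp only [verdict, decide_eq_true_eq, Nat.add_sub_cancel]
  have h1 := Nat.mod_lt j hk
  have h2 := Nat.div_add_mod j k
  constructor
  · intro h
    exact ⟨j / k + 1, by rw [Nat.mul_succ]; omega⟩
  · rintro ⟨q, hq⟩
    -- If `k` divides `j + 1`, then `j` leaves the largest residue `k - 1`, and the shifted residue
    -- is `k`.
    obtain ⟨q', rfl⟩ : ∃ q', q = q' + 1 := Nat.exists_eq_succ_of_ne_zero (by rintro rfl; omega)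
    have h3 : j = k * q' + (k - 1) := by rw [Nat.mul_succ] at hq; omega
    rw [h3, Nat.mul_add_mod, Nat.mod_eq_of_lt (by omega)]
    omega

/-- From the left end of the input to its right end, with the next modulus. -/
theorem detRun_candidate {n k c : ℕ} {v : Verdict} (hn : 0 < n)
    (h0 : ∃ v', (machine p hp).DetRun (List.replicate n ()) (2 * width k + 3)
      (rest p hp N .rewind v 0 k c 0) (rest p hp N .first v' 1 k c 0))
    (hc : c ≤ k) (hN : width (k + 1) ≤ N) :
    ∃ t ≤ (n + 1) * (2 * N + 3), (machine p hp).DetRun (List.replicate n ()) t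
      (rest p hp N .rewind v 0 k c 0)
      (rest p hp N .sweep (verdict (k + 1) ((n - 1) % (k + 1) + 1) 0) (n + 1) (k + 1)
        ((n - 1) % (k + 1) + 1) 0) := by
  have hw := (width_mono k.le_succ).trans hN
  obtain ⟨v', h0⟩ := h0
  have h1 := detRun_rest_succ (p := p) (hp := hp) (N := N) (w := List.replicate n ()) (v := v')
    (i := 1) (fun b => by rw [inputSymbol_letter hn]; rfl) hc hw
  have h2 := detRun_sweep (p := p) (hp := hp) (N := N) (n := n) (k := k + 1) (j := n - 1)
    k.succ_pos hN (by omega)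
  rw [show n - 1 + 2 = n + 1 by omega] at h2
  refine ⟨_, ?_, h0.trans (h1.trans h2)⟩
  calc _ ≤ (2 * N + 3) + ((2 * N + 3) + (n - 1) * (2 * N + 3)) := by gcongr
    _ = (n - 1 + 2) * (2 * N + 3) := by ring
    _ = (n + 1) * (2 * N + 3) := by rw [show n - 1 + 2 = n + 1 by omega]

/-- The start of the computation, with modulus `0` and an empty tape, is treated separately because
`scanFull_tape` needs a positive modulus. -/
theorem exists_detRun_first {w : List Unit} {k c : ℕ} {v : Verdict} (hc : c ≤ k)
    (hk : k = 0 → c = 0) (hN : width k ≤ N) :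
    ∃ v', (machine p hp).DetRun w (2 * width k + 3)
      (rest p hp N .rewind v 0 k c 0) (rest p hp N .first v' 1 k c 0) := by
  rcases Nat.eq_zero_or_pos k with rfl | hpos
  · have hctl : ∀ b, control b .rewind v (inputSymbol w 0) =
        (.scan .first (.begin false false false false), .right) := fun b => rfl
    have h1 := detRun_round (p := p) (hp := hp) (N := N) (l := []) hctl (by simp)
    refine ⟨(scanFull (.begin false false false false) []).1, ?_⟩
    have ht : ∀ c h, tape 0 c h = [] := fun c h => by rw [tape, width_zero]; rfl
    rw [width_zero, rest, rest, ht]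
    exact h1
  · have h1 := detRun_rest (p := p) (hp := hp) (N := N) (w := w) (m := .rewind) (m' := .first)
      (v := v) (i := 0) (k := k) (c := c) (h := 0) (r := false) (b := false) (d := false)
      (mv := .right) (fun b => rfl) hpos (by simpa using hc) hN
    exact ⟨_, by simpa [moveInput] using h1⟩

theorem init_eq :
    (machine p hp).addVisited (cells N) (machine p hp).init =
      rest p hp N .rewind ⟨true, false, false⟩ 0 0 0 0 := by
  have h : ({0} : Finset ℤ) ∪ cells N = cells N :=
    Finset.union_eq_right.2 (by simp [cells])
  rw [rest, tape, width_zero, encode, tapeOf_nil]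
  simp only [addVisited, init, h]
  rfl

/-- The machine determines the least number that does not divide `n`. -/
theorem exists_detRun_search {n : ℕ} (hn : 0 < n) (k : ℕ) (hk : k < leastNonDivisor n)
    (hN : width (leastNonDivisor n) ≤ N) :
    ∃ t ≤ (k + 1) * ((2 * n + 2) * (2 * N + 3)),
      (machine p hp).DetRun (List.replicate n ()) t
        ((machine p hp).addVisited (cells N) (machine p hp).init)
        (rest p hp N .sweep (verdict (k + 1) ((n - 1) % (k + 1) + 1) 0) (n + 1) (k + 1)
          ((n - 1) % (k + 1) + 1) 0) := by
  have hle : ∀ j, j < leastNonDivisor n → width (j + 1) ≤ N := fun j hj =>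
    (width_mono hj).trans hN
  induction k with
  | zero =>
    obtain ⟨t, ht, h⟩ := detRun_candidate (p := p) (hp := hp) (N := N) (n := n) (k := 0) (c := 0)
      hn (exists_detRun_first le_rfl (fun _ => rfl) (by simp [width_zero])) le_rfl (hle 0 hk)
    refine ⟨t, ht.trans ?_, by rw [init_eq]; exact h⟩
    rw [zero_add, one_mul]
    gcongr <;> omega
  | succ k ih =>
    obtain ⟨t, ht, h⟩ := ih (by omega)
    have hwk := hle k (by omega)
    have hc : (n - 1) % (k + 1) + 1 ≤ k + 1 := Nat.mod_lt _ k.succ_pos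
    have heq : (verdict (k + 1) ((n - 1) % (k + 1) + 1) 0).eq = true :=
      (verdict_eq_mod_iff hn k.succ_pos).2 (dvd_of_lt_leastNonDivisor k.succ_pos hk)
    have h1 := detRun_rest (p := p) (hp := hp) (N := N) (w := List.replicate n ()) (m := .sweep)
      (m' := .rewind) (v := verdict (k + 1) ((n - 1) % (k + 1) + 1) 0) (i := n + 1) (k := k + 1)
      (c := (n - 1) % (k + 1) + 1) (h := 0) (r := false) (b := false) (d := false) (mv := .left)
      (fun b => by rw [inputSymbol_rightEnd, control, if_pos heq]) k.succ_pos (by simpa using hc)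
      hwk
    simp only [Bool.toNat_false, add_zero, Bool.false_eq_true, if_false, moveInput,
      Nat.add_sub_cancel] at h1
    obtain ⟨v', h2⟩ := detRun_rewind (p := p) (hp := hp) (N := N) (n := n) (i := n) (h := 0)
      (v := verdict (k + 1) ((n - 1) % (k + 1) + 1) 0) k.succ_pos hc hwk
    obtain ⟨t', ht', h3⟩ := detRun_candidate (p := p) (hp := hp) (N := N) (n := n) (v := v') hn
      (exists_detRun_first hc (by simp) hwk) hc (hle (k + 1) hk)
    refine ⟨_, ?_, h.trans (h1.trans (h2.trans h3))⟩
    have h4 : 2 * width (k + 1) + 3 ≤ 2 * N + 3 := by omega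
    -- A further modulus costs `1 + n` rounds to rewind and `n + 1` rounds to sweep, each of at most
    -- `2 * N + 3` steps.
    calc _ ≤ (k + 1) * ((2 * n + 2) * (2 * N + 3)) +
          ((2 * N + 3) + (n * (2 * N + 3) + (n + 1) * (2 * N + 3))) := by gcongr
      _ = (k + 1 + 1) * ((2 * n + 2) * (2 * N + 3)) := by ring

end DivisorSearch

/-! ### The tossing phase and the resource bounds -/

namespace DivisorSearch

open scoped NNReal
open PTM

variable {p : ℝ≥0} {hp : p ≤ 1} {N : ℕ} {w : List Unit}

/-- Only the control step depends on the coin. It stores the outcome as the initial carry of the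
heads track, and the scan that follows is deterministic. -/
theorem runFrom_toss {i k j h : ℕ} (hj : j < k) (hN : width k ≤ N) :
    (machine p hp).runFrom w (rest p hp N .toss (verdict k j h) i k j h) (2 * width k + 3) =
      (coin p hp).map fun b => rest p hp N .toss (verdict k (j + 1) (h + b.toNat)) i k (j + 1)
        (h + b.toNat) := by
  have hstep : (machine p hp).step w (rest p hp N .toss (verdict k j h) i k j h) =
      (coin p hp).map fun b => config p hp N (.scan .toss (.begin false false true b)) i
        (tapeOf (tape k j h)) 0 := by
    have hh : ¬ (machine p hp).Halted (rest p hp N .toss (verdict k j h) i k j h) :=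
      fun hh => hh.elim nofun nofun
    rw [step, if_neg hh]
    change ((coin p hp).map _).map _ = _
    refine Eq.trans (PMF.map_comp _ _ _) ?_
    congr 1
    funext b
    have hctl : control b .toss (verdict k j h) (inputSymbol w i) =
        (.scan .toss (.begin false false true b), .stay) := by
      have : ¬ (verdict k j h).eq = true := by simp [verdict, hj.ne']
      rw [control, if_neg this]
    change (machine p hp).next (config p hp N _ _ _ _) (transition b (.control .toss (verdict k j h))
      (inputSymbol w i) (tapeOf (tape k j h) 0)) = _
    rw [next_config _ (by simp [transition, moveWork, cells])]
    simp only [transition, hctl, Function.update_eq_self]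
    rfl
  rw [DetRun.runFrom_succ _ (2 * width k + 2), hstep, PMF.bind_map, ← PMF.bind_pure_comp]
  congr 1
  funext b
  have h1 := detRun_scanFull (p := p) (hp := hp) (N := N) (w := w) .toss
    (.begin false false true b) i (tape k j h) (by rwa [length_tape])
  rw [scanFull_tape (by omega) (by simpa using hj), length_tape] at h1
  exact h1.runFrom_eq

/-- The configuration after `j` rounds is a function of the number of heads alone, so the run is the
image of `headCount`, which satisfies the same recursion. -/
theorem runFrom_tosses {i k j : ℕ} (hj : j ≤ k) (hN : width k ≤ N) :
    (machine p hp).runFrom w (rest p hp N .toss (verdict k 0 0) i k 0 0)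
        (j * (2 * width k + 3)) =
      (headCount p hp j).map fun h => rest p hp N .toss (verdict k j h) i k j h := by
  induction j with
  | zero => simp [headCount, runFrom, PMF.pure_map]
  | succ j ih =>
    rw [Nat.succ_mul, runFrom_add, ih (by omega), headCount, PMF.bind_map, PMF.map_bind]
    congr 1
    funext h
    rw [PMF.map_comp]
    exact runFrom_toss (by omega) hN

theorem runFrom_tosses_end {i k : ℕ} (hN : width k ≤ N) :
    (machine p hp).runFrom w (rest p hp N .toss (verdict k 0 0) i k 0 0)
        (k * (2 * width k + 3) + 1) =
      (headCount p hp k).map fun h => config p hp N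
        (if (verdict k k h).top then .accept else .reject) i (tapeOf (tape k k h)) 0 := by
  rw [runFrom, runFrom_tosses le_rfl hN, PMF.bind_map, ← PMF.bind_pure_comp]
  congr 1
  funext h
  refine (detStep_control (mv := .stay) fun b => ?_).step_eq
  rw [control, if_pos (by simp [verdict])]

/-- A computation without randomness that ends in the rejecting state. -/
theorem haltsWithin_of_detRun_reject {T i : ℕ} {U : ℤ → Option Cell} {z : ℤ}
    (h : (machine p hp).DetRun w T ((machine p hp).addVisited (cells N) (machine p hp).init)
      (config p hp N .reject i U z)) :
    (machine p hp).HaltsWithin w (cells N) T ∧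
      (∀ t, ∃ c, (machine p hp).run w t = PMF.pure c) ∧ (machine p hp).acceptProb w = 0 := by
  have hd : (machine p hp).Halted (config p hp N .reject i U z) := Or.inr rfl
  have H : (machine p hp).HaltsWithin w (cells N) T := by
    constructor <;> intro d hd' <;>
      rw [h.runFrom_eq, PMF.support_pure, Set.mem_singleton_iff] at hd' <;> subst hd'
    · exact hd
    · exact Finset.Subset.refl _
  refine ⟨H, h.exists_run_eq_pure hd, ?_⟩
  rw [H.acceptProb_eq, h.runFrom_eq, PMF.toOuterMeasure_pure_apply, if_neg, ENNReal.toReal_zero]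
  exact nofun

theorem acceptProb_tosses {T i m : ℕ} (hN : width (64 ^ m) ≤ N)
    (h : (machine p hp).DetRun w T ((machine p hp).addVisited (cells N) (machine p hp).init)
      (rest p hp N .toss (verdict (64 ^ m) 0 0) i (64 ^ m) 0 0)) :
    (machine p hp).HaltsWithin w (cells N) (T + (64 ^ m * (2 * width (64 ^ m) + 3) + 1)) ∧
      (machine p hp).acceptProb w = headCountBitProb p (64 ^ m) (3 * m + 2) := by
  have hrun := runFrom_add _ w ((machine p hp).addVisited (cells N) (machine p hp).init) T
    (64 ^ m * (2 * width (64 ^ m) + 3) + 1)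
  rw [h.runFrom_eq, PMF.pure_bind, runFrom_tosses_end hN] at hrun
  have H : (machine p hp).HaltsWithin w (cells N)
      (T + (64 ^ m * (2 * width (64 ^ m) + 3) + 1)) := by
    constructor <;> intro d hd <;> rw [hrun, PMF.mem_support_map_iff] at hd <;>
      obtain ⟨j, -, rfl⟩ := hd
    · by_cases hv : (verdict (64 ^ m) (64 ^ m) j).top = true
      · exact Or.inl (if_pos hv)
      · exact Or.inr (if_neg hv)
    · exact Finset.Subset.refl _
  refine ⟨H, ?_⟩
  rw [H.acceptProb_eq, hrun, PMF.toOuterMeasure_map_apply, ← toReal_headCount_testBit p hp]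
  congr 2
  ext j
  change (if (verdict (64 ^ m) (64 ^ m) j).top then State.accept else .reject) = .accept ↔
    j.testBit (3 * m + 2) = true
  rw [verdict_top]
  split_ifs with hv <;> simp [hv]

-- The number of digits of `F(n)` bounds the tape throughout the search, as the moduli increase up
-- to `F(n)`. The time bound sums the search, one round that resets the counter, the `F(n) ≤ n + 1`
-- tosses and a final decision.
variable (p hp) in
theorem exists_haltsWithin (n : ℕ) :
    ∃ T ≤ ((n + 1) * (2 * n + 2) + n + 2) * (2 * n + 5) + 2,
      (machine p hp).HaltsWithin (List.replicate n ()) (cells (width (leastNonDivisor n))) T ∧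
      ((n = 0 ∨ ∀ m : ℕ+, leastNonDivisor n ≠ 64 ^ (m : ℕ)) →
        (∀ t : ℕ, ∃ c, (machine p hp).run (List.replicate n ()) t = PMF.pure c) ∧
        (machine p hp).acceptProb (List.replicate n ()) = 0) ∧
      (0 < n → ∀ m : ℕ+, leastNonDivisor n = 64 ^ (m : ℕ) →
        (machine p hp).acceptProb (List.replicate n ()) =
          headCountBitProb p (64 ^ (m : ℕ)) (3 * (m : ℕ) + 2)) := by
  rcases Nat.eq_zero_or_pos n with rfl | hn
  · obtain ⟨v, h1⟩ := exists_detRun_first (p := p) (hp := hp)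
      (N := width (leastNonDivisor 0)) (w := List.replicate 0 ()) (k := 0) (c := 0)
      (v := ⟨true, false, false⟩) le_rfl (fun _ => rfl) (by simp [width_zero])
    have h2 : (machine p hp).DetStep (List.replicate 0 ())
        (rest p hp (width (leastNonDivisor 0)) .first v 1 0 0 0) _ :=
      detStep_control (s := .reject) (mv := .stay) fun b => rfl
    rw [← init_eq] at h1
    have h3 := haltsWithin_of_detRun_reject (h1.trans h2.detRun)
    exact ⟨_, by simp [width_zero], h3.1, fun _ => h3.2, fun h => absurd h (lt_irrefl 0)⟩
  · set k := leastNonDivisor n with hk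
    obtain ⟨hk0, hkn⟩ := leastNonDivisor_spec hn
    rw [← hk] at hk0 hkn
    have hkle : k ≤ n + 1 := leastNonDivisor_le_succ hn
    have hwle : width k ≤ n + 1 := (width_le k).trans hkle
    obtain ⟨t, ht, h1⟩ := exists_detRun_search (p := p) (hp := hp) (N := width k) hn (k - 1)
      (by omega) le_rfl
    rw [Nat.sub_add_cancel hk0] at ht h1
    have ht' : t ≤ (n + 1) * (2 * n + 2) * (2 * n + 5) := by
      rw [← mul_assoc] at ht
      refine ht.trans ?_
      gcongr ?_ * _ * ?_; omega
    have heq : ¬ (verdict k ((n - 1) % k + 1) 0).eq = true := by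
      rwa [verdict_eq_mod_iff hn hk0]
    by_cases hpow : (verdict k ((n - 1) % k + 1) 0).pow = true
    · obtain ⟨m, hm⟩ := verdict_pow_iff.1 hpow
      -- The modulus `1 = 64 ^ 0` passes the power test as well, but it divides every `n` and so
      -- never is the least non-divisor.
      have hm0 : 0 < m := by
        rcases Nat.eq_zero_or_pos m with rfl | h
        · rw [hm, pow_zero] at hkn
          exact absurd (one_dvd n) hkn
        · exact h
      have h2 := detRun_rest (p := p) (hp := hp) (N := width k) (w := List.replicate n ())
        (m := .sweep) (m' := .toss) (v := verdict k ((n - 1) % k + 1) 0) (i := n + 1) (k := k)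
        (c := (n - 1) % k + 1) (h := 0) (r := true) (b := false) (d := false) (mv := .stay)
        (fun b => by rw [inputSymbol_rightEnd, control, if_neg heq, if_pos hpow]) hk0 (by simp)
        le_rfl
      have h3 := h1.trans h2
      simp only [if_true, Bool.toNat_false, add_zero, moveInput, hm] at h3
      obtain ⟨H, hacc⟩ := acceptProb_tosses le_rfl h3
      rw [← hm] at H hacc h3
      refine ⟨_, ?_, H, ?_, ?_⟩
      · have h4 : 2 * width k + 3 ≤ 2 * n + 5 := by omega
        have h5 : k * (2 * width k + 3) ≤ (n + 1) * (2 * n + 5) := by gcongr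
        linarith
      · rintro (h | h)
        · omega
        · exact absurd hm (h ⟨m, hm0⟩)
      · intro _ m' hm'
        have : m = m' := Nat.pow_right_injective (by norm_num : 2 ≤ 64) (hm.symm.trans hm')
        rw [hacc, ← this, hm]
    · have h2 : (machine p hp).DetStep (List.replicate n ())
          (rest p hp (width k) .sweep (verdict k ((n - 1) % k + 1) 0) (n + 1) k
            ((n - 1) % k + 1) 0) _ :=
        detStep_control (s := .reject) (mv := .stay) fun b => by
          rw [inputSymbol_rightEnd, control, if_neg heq, if_neg hpow]
      have h3 := haltsWithin_of_detRun_reject (h1.trans h2.detRun)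
      refine ⟨_, ?_, h3.1, fun _ => h3.2, fun _ m hm => ?_⟩
      · linarith [Nat.zero_le ((n + 2) * (2 * n + 5))]
      · exact absurd (verdict_pow_iff.2 ⟨m, hm⟩) hpow

theorem card_cells (N : ℕ) : (cells N).card = N + 2 := by
  rw [cells, Int.card_Icc]; omega

theorem eq_replicate_length (w : List Unit) : w = List.replicate w.length () :=
  List.eq_replicate_iff.2 ⟨rfl, fun _ _ => rfl⟩

variable (p hp) in
theorem polynomialTime_machine : (machine p hp).PolynomialTime := by
  refine ⟨((.X + 1) * (2 * .X + 2) + .X + 2) * (2 * .X + 5) + 2, fun w c hc => ?_⟩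
  obtain ⟨T, hT, H, -⟩ := exists_haltsWithin p hp w.length
  rw [← eq_replicate_length] at H
  rw [H.run_eq (by simpa using hT)] at hc
  exact H.halted_run hc

variable (p hp) in
theorem spaceBigO_machine :
    (machine p hp).SpaceBigO fun n => Real.log (Real.log n) := by
  -- The two further cells are the blanks on either side, at which the head turns around.
  refine ⟨fun n => width (leastNonDivisor n) + 2, fun w t c hc => ?_,
    isBigO_clog_leastNonDivisor 2⟩
  obtain ⟨T, -, H, -⟩ := exists_haltsWithin p hp w.length
  rw [← eq_replicate_length] at H
  exact (Finset.card_le_card (H.visited_run hc)).trans_eq (card_cells _)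

end DivisorSearch

/-! ### The recognition theorem and uncountability -/

open DivisorSearch in
theorem exists_machine_AM75' (I : Set ℕ+) : ∃ M : PTM Unit,
      (∀ s σ γ r, M.δ s σ γ r ∈
        ({0, 1, ENNReal.ofReal (coinBias I), ENNReal.ofReal (1 - coinBias I)} : Set ENNReal)) ∧
      M.PolynomialTime ∧
      M.SpaceBigO (fun n => Real.log (Real.log n)) ∧
      M.RecognizesWithError (AM75' I) (1 / 4) ∧
      (∀ n : ℕ, (n = 0 ∨ ∀ m : ℕ+, leastNonDivisor n ≠ 64 ^ (m : ℕ)) →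
        (∀ t : ℕ, ∃ c, M.run (List.replicate n ()) t = PMF.pure c) ∧
        M.acceptProb (List.replicate n ()) = 0) ∧
      (∀ n : ℕ, 0 < n → ∀ m : ℕ+, leastNonDivisor n = 64 ^ (m : ℕ) →
        M.acceptProb (List.replicate n ()) =
          headCountBitProb (coinBias I) (64 ^ (m : ℕ)) (3 * (m : ℕ) + 2)) := by
  have hp : (coinBias I).toNNReal ≤ 1 := Real.toNNReal_le_one.2 (coinBias_le_one I)
  have hacc : ∀ n : ℕ, 0 < n → ∀ m : ℕ+, leastNonDivisor n = 64 ^ (m : ℕ) →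
      (machine _ hp).acceptProb (List.replicate n ()) =
        headCountBitProb (coinBias I) (64 ^ (m : ℕ)) (3 * (m : ℕ) + 2) := by
    intro n hn m hm
    obtain ⟨-, -, -, -, h⟩ := exists_haltsWithin _ hp n
    rw [h hn m hm, Real.coe_toNNReal _ (coinBias_nonneg I)]
  have hdet : ∀ n : ℕ, (n = 0 ∨ ∀ m : ℕ+, leastNonDivisor n ≠ 64 ^ (m : ℕ)) →
      (∀ t : ℕ, ∃ c, (machine _ hp).run (List.replicate n ()) t = PMF.pure c) ∧
        (machine _ hp).acceptProb (List.replicate n ()) = 0 := by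
    intro n
    obtain ⟨-, -, -, h, -⟩ := exists_haltsWithin _ hp n
    exact h
  refine ⟨machine _ hp, fun s σ γ r => ?_, polynomialTime_machine _ hp, spaceBigO_machine _ hp,
    ⟨?_, ?_⟩, hdet, hacc⟩
  · have h := machine_δ_mem _ hp s σ γ r
    have h1 : ENNReal.ofReal (1 - coinBias I) = ((1 - (coinBias I).toNNReal : NNReal) : ENNReal) := by
      rw [ENNReal.ofReal, NNReal.sub_def, Real.coe_toNNReal _ (coinBias_nonneg I), NNReal.coe_one]
    rw [h1]
    exact h
  · rintro w ⟨n, hn, rfl, m, hm, hI⟩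
    rw [hacc n hn m hm]
    linarith [headCountBitProb_of_mem hI]
  · intro w hw
    rw [eq_replicate_length w] at hw ⊢
    generalize w.length = n at hw ⊢
    by_cases h : n = 0 ∨ ∀ m : ℕ+, leastNonDivisor n ≠ 64 ^ (m : ℕ)
    · rw [(hdet n h).2]
      norm_num
    · push Not at h
      obtain ⟨hn, m, hm⟩ := h
      rw [hacc n (Nat.pos_of_ne_zero hn) m hm]
      exact headCountBitProb_of_notMem fun hI => hw ⟨n, Nat.pos_of_ne_zero hn, rfl, m, hm, hI⟩

theorem mainTheorem1 :
    (∀ I : Set ℕ+, ∃ M : PTM Unit,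
      (∀ s σ γ r, M.δ s σ γ r ∈
        ({0, 1, ENNReal.ofReal (coinBias I), ENNReal.ofReal (1 - coinBias I)} : Set ENNReal)) ∧
      M.PolynomialTime ∧
      M.SpaceBigO (fun n => Real.log (Real.log n)) ∧
      M.RecognizesWithError (AM75' I) (1 / 4) ∧
      (∀ n : ℕ, (n = 0 ∨ ∀ m : ℕ+, leastNonDivisor n ≠ 64 ^ (m : ℕ)) →
        (∀ t : ℕ, ∃ c, M.run (List.replicate n ()) t = PMF.pure c) ∧
        M.acceptProb (List.replicate n ()) = 0) ∧
      (∀ n : ℕ, 0 < n → ∀ m : ℕ+, leastNonDivisor n = 64 ^ (m : ℕ) →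
        M.acceptProb (List.replicate n ()) =
          headCountBitProb (coinBias I) (64 ^ (m : ℕ)) (3 * (m : ℕ) + 2))) ∧
    ¬ (Set.range AM75').Countable ∧
    ¬ {L : Language Unit | ∃ M : PTM Unit, M.PolynomialTime ∧
        M.SpaceBigO (fun n => Real.log (Real.log n)) ∧
        M.RecognizesWithBoundedError L}.Countable := by
  refine ⟨exists_machine_AM75', not_countable_range_AM75', fun h =>
    not_countable_range_AM75' (h.mono ?_)⟩
  rintro _ ⟨I, rfl⟩
  obtain ⟨M, -, h1, h2, h3, -⟩ := exists_machine_AM75' I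
  exact ⟨M, h1, h2, 1 / 4, by norm_num, by norm_num, h3⟩
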